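/- Let $E$ be a Polish space with a distance $d$ inducing its topology, let $p\ge 1$, let $\mathcal P(E)$ be the set of Borel probability measures on $E$ and $\mathcal P_p(E)$ the set of those with finite $p$-th moment. For $\mathbf x=(x^1,\dots,x^N)\in E^N$ put $\mu_{\mathbf x}=\frac1N\sum_{i=1}^N\delta_{x^i}$. For a measurable metric $\delta$ on $\mathcal P(E)$, the distance $W_{\delta,p}$ on $\mathcal P(\mathcal P(E))$ is $W_{\delta,p}(F,G)=\inf_\gamma\big(\int\delta(\mu,\nu)^p\,\gamma(\mathrm d\mu,\mathrm d\nu)\big)^{1/p}$, the infimum being over all couplings $\gamma$ of $F$ and $G$; similarly $W_p$ denotes the Wasserstein-$p$ distance on $\mathcal P(E)$ associated with $d$. A compatible symmetric sequence is a sequence $(f^N)_{N\ge1}$ of permutation-invariant probability measures $f^N$ on $E^N$ such that the marginal of $f^k$ on the first $j$ coordinates is $f^j$ for all $1\le j\le k$; $\mathcal X^N$ denotes an $f^N$-distributed vector. A rate is a function $\varepsilon$ with $\varepsilon(N)>0$ for $N\ge1$ and $\varepsilon(N)\to0$ as $N\to\infty$. (1) Let $\delta$ be a measurable metric on $\mathcal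 P(E)$ satisfying a uniform $\delta^p$-law of large numbers with rate $\varepsilon$: for every $N\ge1$, every $g\in\mathcal P_p(E)$ and every $g^{\otimes N}$-distributed vector $\overline{\mathcal X}^N$, $$\mathbb E\big[\delta^p(\mu_{\overline{\mathcal X}^N},g)\big]^{1/p}\le\varepsilon(N).$$ Then for every compatible symmetric sequence $(f^N)_N$ and all $1\le M\le N$, $$W_{\delta,p}\big(\mathrm{Law}(\mu_{\mathcal X^M}),\mathrm{Law}(\mu_{\mathcal X^N})\big)\le\varepsilon(M)+\varepsilon(N);$$ in particular, if $\varepsilon$ is nonincreasing, the left-hand side is at most $2\,\varepsilon(M)$. (2) Let $d$ be bounded. Then $W_p$ is a measurable metric on $\mathcal P(E)$, and: (a) If $(E,d)$ is totally bounded (for instance compact, or a bounded Polish subset of $\mathbb R^n$ with the Euclidean distance), then $\delta=W_p$ satisfies a uniform $\delta^p$-law of large numbers with some nonincreasing rate $\varepsilon$, and for every compatible symmetric sequence and all $1\le M\le N$, $W_{W_p,p}\big(\mathrm{Law}(\mu_{\mathcal X^M}),\mathrm{Law}(\mu_{\mathcal X^N})\big)\le2\,\varepsilon(M)$. (b) In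 general, for every $g\in\mathcal P(E)$ there is a nonincreasing rate $\varepsilon$, which may depend on $g$, such that $\mathbb E\big[W_p^p(\mu_{\overline{\mathcal X}^N},g)\big]^{1/p}\le\varepsilon(N)$ for all $N\ge1$ and $g^{\otimes N}$-distributed $\overline{\mathcal X}^N$, and such that for every compatible symmetric sequence with $f^1=g$ and all $1\le M\le N$, $W_{W_p,p}\big(\mathrm{Law}(\mu_{\mathcal X^M}),\mathrm{Law}(\mu_{\mathcal X^N})\big)\le2\,\varepsilon(M)$. -/

import Mathlib

open MeasureTheory Filter Topology
open scoped ENNReal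

/-- The uniform probability measure on the points `x 0, …, x (N - 1)`, repetitions counted:
`(1 / N) ∑ i, δ_{x i}`, for `N ≥ 1`. -/
noncomputable def empiricalMeasure {E : Type*} [MeasurableSpace E] {N : ℕ} [NeZero N]
    (x : Fin N → E) : ProbabilityMeasure E :=
  ⟨(N : ℝ≥0∞)⁻¹ • ∑ i, Measure.dirac (x i), ⟨by
    have h : (N : ℝ≥0∞) ≠ 0 := by exact_mod_cast NeZero.ne N
    simp [Measure.finsetSum_apply, ENNReal.inv_mul_cancel h (ENNReal.natCast_ne_top N)]⟩⟩

theorem measurable_empiricalMeasure {E : Type*} [MeasurableSpace E] {N : ℕ} [NeZero N] :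
    Measurable (empiricalMeasure : (Fin N → E) → ProbabilityMeasure E) := by
  refine Measurable.subtype_mk (Measure.measurable_of_measurable_coe _ fun s hs => ?_)
  simp only [Measure.smul_apply, Measure.finsetSum_apply, smul_eq_mul]
  refine Measurable.const_mul (Finset.measurable_sum _ fun i _ => ?_) _
  exact (Measure.measurable_coe hs).comp (Measure.measurable_dirac.comp (measurable_pi_apply i))

/-- The law, in the space of probability measures on `P(E)`, of the random empirical measure
of an `N`-tuple with law `P`. -/
noncomputable def empiricalLaw {E : Type*} [MeasurableSpace E] {N : ℕ} [NeZero N]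
    (P : ProbabilityMeasure (Fin N → E)) : ProbabilityMeasure (ProbabilityMeasure E) :=
  P.map (f := empiricalMeasure) measurable_empiricalMeasure.aemeasurable

/-- A probability measure on `E ^ N` which is invariant under permutations of the coordinates. -/
def IsSymmetricMeasure {E : Type*} [MeasurableSpace E] {N : ℕ}
    (P : ProbabilityMeasure (Fin N → E)) : Prop :=
  ∀ σ : Equiv.Perm (Fin N),
    (P : Measure (Fin N → E)).map (fun x i => x (σ i)) = (P : Measure (Fin N → E))

/-- A sequence of symmetric probability measures `f N` on `E ^ N` such that the marginal of `f k`
on the first `j` coordinates is `f j`, for all `1 ≤ j ≤ k`. -/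
structure IsCompatibleSymmetric {E : Type*} [MeasurableSpace E]
    (f : ∀ N : ℕ, ProbabilityMeasure (Fin N → E)) : Prop where
  symmetric : ∀ N : ℕ, 1 ≤ N → IsSymmetricMeasure (f N)
  compatible : ∀ (j k : ℕ) (hjk : j ≤ k), 1 ≤ j →
    (f k : Measure (Fin k → E)).map (fun x (i : Fin j) => x (Fin.castLE hjk i)) =
      (f j : Measure (Fin j → E))

/-- `δ` is a metric (a finite distance function) on the set `X`. -/
structure IsMetricFun {X : Type*} (δ : X → X → ℝ) : Prop where
  eq_zero_iff : ∀ x y, δ x y = 0 ↔ x = y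
  symm : ∀ x y, δ x y = δ y x
  triangle : ∀ x y z, δ x z ≤ δ x y + δ y z

/-- The set `Π(μ, ν)` of couplings of `μ` and `ν`. -/
def couplings {X : Type*} [MeasurableSpace X] (μ ν : ProbabilityMeasure X) :
    Set (ProbabilityMeasure (X × X)) :=
  {γ | (γ : Measure (X × X)).map Prod.fst = (μ : Measure X) ∧
    (γ : Measure (X × X)).map Prod.snd = (ν : Measure X)}

/-- The Wasserstein distance `W_{δ,p}` of order `p` associated to the distance function `δ`, with
values in `[0, ∞]`: the infimum of `(∫ δ(x, y) ^ p dγ) ^ (1 / p)` over all couplings `γ`. -/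
noncomputable def wasserstein {X : Type*} [MeasurableSpace X] (δ : X → X → ℝ) (p : ℝ)
    (μ ν : ProbabilityMeasure X) : ℝ≥0∞ :=
  ⨅ γ ∈ couplings μ ν,
    (∫⁻ z : X × X, ENNReal.ofReal (δ z.1 z.2) ^ p ∂(γ : Measure (X × X))) ^ (1 / p)

/-- The Wasserstein-`p` distance on the probability measures on a metric space `E`, as a real
number; it is used for bounded `E` only, where all values of `wasserstein dist p` are finite. -/
noncomputable def wassersteinReal (E : Type*) [MetricSpace E] [MeasurableSpace E] (p : ℝ)
    (μ ν : ProbabilityMeasure E) : ℝ :=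
  (wasserstein (dist : E → E → ℝ) p μ ν).toReal

/-- `μ` has a finite `p`-th moment, that is, `μ` belongs to `P_p(E)`. -/
def HasFiniteMoment {E : Type*} [MetricSpace E] [MeasurableSpace E] (p : ℝ)
    (μ : ProbabilityMeasure E) : Prop :=
  ∃ x₀ : E, ∫⁻ x, ENNReal.ofReal (dist x x₀) ^ p ∂(μ : Measure E) < ∞

/-- `𝔼[δ(μ_X, g) ^ p] ^ (1 / p)`, where `μ_X` is the empirical measure of `N` independent
`g`-distributed random variables. -/
noncomputable def iidError {E : Type*} [MeasurableSpace E]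
    (δ : ProbabilityMeasure E → ProbabilityMeasure E → ℝ) (p : ℝ) (N : ℕ) [NeZero N]
    (g : ProbabilityMeasure E) : ℝ≥0∞ :=
  (∫⁻ x : Fin N → E, ENNReal.ofReal (δ (empiricalMeasure x) g) ^ p
    ∂(Measure.pi fun _ : Fin N => (g : Measure E))) ^ (1 / p)

/-- `ε(N)`, `N ≥ 1`, is a rate: a sequence of positive numbers which tends to zero. -/
structure IsRate (ε : ℕ → ℝ) : Prop where
  pos : ∀ N : ℕ, 1 ≤ N → 0 < ε N
  tendsto : Tendsto ε atTop (𝓝 0)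

/-- The uniform `δ ^ p`-law of large numbers with rate `ε`: the bound holds for all `g` in
`P_p(E)` simultaneously. -/
structure UniformLLN {E : Type*} [MetricSpace E] [MeasurableSpace E]
    (δ : ProbabilityMeasure E → ProbabilityMeasure E → ℝ) (p : ℝ) (ε : ℕ → ℝ) : Prop where
  isRate : IsRate ε
  bound : ∀ (N : ℕ) [NeZero N] (g : ProbabilityMeasure E), HasFiniteMoment p g →
    iidError δ p N g ≤ ENNReal.ofReal (ε N)

/-! ### Couplings and the Wasserstein distance of a general cost -/

section Couplings

variable {X : Type*} [MeasurableSpace X]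

/-! The Cauchy estimate is a sampling argument that avoids de Finetti's theorem. Couple the two laws
by the empirical measures of two disjoint blocks, of sizes `M` and `N`, of one vector with law `f (M
+ N)`. To bound the cost of this coupling, take a large population `x` with law `f K` and draw `M +
N` indices independently and uniformly. Given `x`, the draws are i.i.d. with law `empiricalMeasure
x`, so each block's empirical measure is within its i.i.d. error of `empiricalMeasure x`; the
triangle inequality and Minkowski give the sum of the two errors. When the indices are distinct, the
sample has exactly the law `f (M + N)`, by exchangeability and compatibility. Distinctness is
independent of `x` and its probability tends to one as `K` grows, so the bound passes to the
coupling. This is `wasserstein_empiricalLaw_le`; it needs the law of large numbers only at empirical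
measures, and only on average over `f K`.

For `W_p` on a bounded space, cut `E` into countably many disjoint cells of small diameter. Matching
mass inside finitely many cells and transporting the rest at maximal cost bounds `W_p ^ p` by cell
diameters, uncovered mass and mass deficits in the cells (`wasserstein_rpow_le_partition`). Each
deficit of an empirical measure has mean at most `1 / √N`. If `E` is totally bounded, finitely many
cells leave nothing uncovered, whence uniformity. In general the uncovered mass enters linearly, and
the mean of `empiricalMeasure x` under `f K` is the one-particle law `g`; cells adapted to `g` thus
control the average over random populations. -/

theorem wasserstein_le_of_mem_couplings (δ : X → X → ℝ) (p : ℝ) {μ ν : ProbabilityMeasure X}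
    {γ : ProbabilityMeasure (X × X)} (hγ : γ ∈ couplings μ ν) :
    wasserstein δ p μ ν ≤
      (∫⁻ z : X × X, ENNReal.ofReal (δ z.1 z.2) ^ p ∂(γ : Measure (X × X))) ^ (1 / p) :=
  iInf₂_le γ hγ

theorem exists_mem_couplings_of_wasserstein_lt {δ : X → X → ℝ} {p : ℝ}
    {μ ν : ProbabilityMeasure X} {c : ℝ≥0∞} (h : wasserstein δ p μ ν < c) :
    ∃ γ ∈ couplings μ ν,
      (∫⁻ z : X × X, ENNReal.ofReal (δ z.1 z.2) ^ p ∂(γ : Measure (X × X))) ^ (1 / p) < c := by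
  simpa only [wasserstein, iInf_lt_iff, exists_prop] using h

theorem wasserstein_le_of_map_eq {Ω : Type*} [MeasurableSpace Ω] {P : Measure Ω}
    [IsProbabilityMeasure P] {δ : X → X → ℝ} (hδ : Measurable (Function.uncurry δ)) (p : ℝ)
    {μ ν : ProbabilityMeasure X} {u v : Ω → X} (hu : Measurable u) (hv : Measurable v)
    (hμ : P.map u = μ) (hν : P.map v = ν) :
    wasserstein δ p μ ν ≤ (∫⁻ ω, ENNReal.ofReal (δ (u ω) (v ω)) ^ p ∂P) ^ (1 / p) := by
  have huv : Measurable fun ω => (u ω, v ω) := hu.prodMk hv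
  let γ : ProbabilityMeasure (X × X) :=
    ⟨P.map fun ω => (u ω, v ω), Measure.isProbabilityMeasure_map huv.aemeasurable⟩
  have hγ : γ ∈ couplings μ ν := by
    constructor
    · change (P.map fun ω => (u ω, v ω)).map Prod.fst = _
      rw [Measure.map_map measurable_fst huv, ← hμ]; rfl
    · change (P.map fun ω => (u ω, v ω)).map Prod.snd = _
      rw [Measure.map_map measurable_snd huv, ← hν]; rfl
  refine (wasserstein_le_of_mem_couplings δ p hγ).trans_eq ?_
  congr 1
  exact lintegral_map ((ENNReal.measurable_ofReal.comp hδ).pow_const p) huv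

theorem wasserstein_comm {δ : X → X → ℝ} (hδ : Measurable (Function.uncurry δ))
    (hsymm : ∀ x y, δ x y = δ y x) (p : ℝ) (μ ν : ProbabilityMeasure X) :
    wasserstein δ p μ ν = wasserstein δ p ν μ := by
  have key : ∀ μ ν : ProbabilityMeasure X, wasserstein δ p μ ν ≤ wasserstein δ p ν μ := by
    intro μ ν
    refine le_iInf₂ fun γ hγ => ?_
    refine (wasserstein_le_of_map_eq hδ p measurable_snd measurable_fst hγ.2 hγ.1).trans_eq ?_
    simp only [hsymm]
  exact le_antisymm (key μ ν) (key ν μ)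

/-- The gluing lemma. -/
theorem exists_gluing [StandardBorelSpace X] {μ ν ρ : ProbabilityMeasure X}
    {γ₁ γ₂ : ProbabilityMeasure (X × X)} (h₁ : γ₁ ∈ couplings μ ν) (h₂ : γ₂ ∈ couplings ν ρ) :
    ∃ π : Measure ((X × X) × X), IsProbabilityMeasure π ∧
      π.map Prod.fst = (γ₁ : Measure (X × X)) ∧
      π.map (fun z => (z.1.2, z.2)) = (γ₂ : Measure (X × X)) := by
  have : Nonempty X := (ProbabilityMeasure.nonempty μ)
  -- Disintegrate `γ₂` over its first marginal and draw the third point from the second one alone,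
  -- independently of the first.
  let κ : ProbabilityTheory.Kernel X X := (γ₂ : Measure (X × X)).condKernel
  let π : Measure ((X × X) × X) := (γ₁ : Measure (X × X)).compProd (κ.comap Prod.snd measurable_snd)
  have hκ : (ν : Measure X).compProd κ = (γ₂ : Measure (X × X)) := by
    rw [← h₂.1]
    exact (γ₂ : Measure (X × X)).disintegrate κ
  refine ⟨π, inferInstance, Measure.fst_compProd _ _, ?_⟩
  have hm : Measurable fun z : (X × X) × X => (z.1.2, z.2) := by fun_prop
  rw [← hκ]
  ext s hs
  rw [Measure.map_apply hm hs, Measure.compProd_apply (hm hs), Measure.compProd_apply hs, ← h₁.2,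
    lintegral_map (ProbabilityTheory.Kernel.measurable_kernel_prodMk_left hs) measurable_snd]
  rfl

/-- Glue the two couplings along `ν` and apply Minkowski's inequality in `L^p` of the glued measure.
-/
theorem wasserstein_triangle [StandardBorelSpace X] {δ : X → X → ℝ}
    (hδ : Measurable (Function.uncurry δ)) (h0 : ∀ x y, 0 ≤ δ x y)
    (htri : ∀ x y z, δ x z ≤ δ x y + δ y z) {p : ℝ} (hp : 1 ≤ p)
    (μ ν ρ : ProbabilityMeasure X) :
    wasserstein δ p μ ρ ≤ wasserstein δ p μ ν + wasserstein δ p ν ρ := by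
  simp only [wasserstein, ENNReal.iInf_add, ENNReal.add_iInf]
  refine le_iInf₂ fun γ₂ h₂ => le_iInf₂ fun γ₁ h₁ => ?_
  obtain ⟨π, hπ, hπ₁, hπ₂⟩ := exists_gluing h₁ h₂
  have hm : Measurable fun z : (X × X) × X => (z.1.2, z.2) := by fun_prop
  have hδ' : Measurable fun z : X × X => ENNReal.ofReal (δ z.1 z.2) :=
    ENNReal.measurable_ofReal.comp hδ
  have hle : wasserstein δ p μ ρ ≤
      (∫⁻ z, ENNReal.ofReal (δ z.1.1 z.2) ^ p ∂π) ^ (1 / p) := by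
    refine wasserstein_le_of_map_eq hδ p (measurable_fst.comp measurable_fst) measurable_snd ?_ ?_
    · rw [← h₁.1, ← hπ₁, Measure.map_map measurable_fst measurable_fst]; rfl
    · rw [← h₂.2, ← hπ₂, Measure.map_map measurable_snd hm]; rfl
  refine hle.trans ?_
  rw [← hπ₁, ← hπ₂, lintegral_map (hδ'.pow_const p) measurable_fst,
    lintegral_map (hδ'.pow_const p) hm]
  refine le_trans ?_ (ENNReal.lintegral_Lp_add_le
    (f := fun z : (X × X) × X => ENNReal.ofReal (δ z.1.1 z.1.2))
    (g := fun z : (X × X) × X => ENNReal.ofReal (δ z.1.2 z.2))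
    (hδ'.comp measurable_fst).aemeasurable (hδ'.comp hm).aemeasurable hp)
  gcongr with z
  simp only [Pi.add_apply]
  rw [← ENNReal.ofReal_add (h0 _ _) (h0 _ _)]
  exact ENNReal.ofReal_le_ofReal (htri _ _ _)

theorem prod_mem_couplings (μ ν : ProbabilityMeasure X) : μ.prod ν ∈ couplings μ ν := by
  constructor <;> simp [ProbabilityMeasure.toMeasure_prod]

theorem wasserstein_le_ofReal {δ : X → X → ℝ} {D p : ℝ} (hD : ∀ x y, δ x y ≤ D) (hp : 1 ≤ p)
    (μ ν : ProbabilityMeasure X) : wasserstein δ p μ ν ≤ ENNReal.ofReal D := by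
  have hp0 : 0 < p := zero_lt_one.trans_le hp
  refine (wasserstein_le_of_mem_couplings δ p (prod_mem_couplings μ ν)).trans ?_
  rw [one_div, ENNReal.rpow_inv_le_iff hp0]
  calc _ ≤ ∫⁻ _ : X × X, ENNReal.ofReal D ^ p ∂(μ.prod ν : Measure (X × X)) := by
        gcongr; exact hD _ _
    _ = _ := by simp

theorem wasserstein_self {δ : X → X → ℝ} (hδ : Measurable (Function.uncurry δ))
    (h0 : ∀ x, δ x x = 0) {p : ℝ} (hp : 1 ≤ p) (μ : ProbabilityMeasure X) :
    wasserstein δ p μ μ = 0 := by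
  have hp0 : 0 < p := zero_lt_one.trans_le hp
  refine le_antisymm ((wasserstein_le_of_map_eq (P := (μ : Measure X)) hδ p measurable_id
    measurable_id Measure.map_id Measure.map_id).trans ?_) zero_le
  simp [h0, hp0, ENNReal.zero_rpow_of_pos]

end Couplings

theorem exists_dist_le {E : Type*} [MetricSpace E] [BoundedSpace E] : ∃ D : ℝ, ∀ x y : E, dist x y ≤ D := by
  obtain ⟨C, hC⟩ := Metric.isBounded_iff.1 (BoundedSpace.bounded_univ (α := E))
  exact ⟨C, fun x y => hC (Set.mem_univ x) (Set.mem_univ y)⟩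

/-! ### `W_p` as a metric over a bounded space -/

section Metric

variable {E : Type*} [MetricSpace E] [MeasurableSpace E]

/-- By Markov's inequality, couplings of vanishing cost force the Lévy–Prokhorov distance to vanish,
and that distance separates measures on closed sets. No attainment of the infimum is needed. -/
theorem eq_of_wasserstein_dist_eq_zero [BorelSpace E] [SecondCountableTopology E] {p : ℝ}
    (hp : 1 ≤ p) {μ ν : ProbabilityMeasure E}
    (h : wasserstein (dist : E → E → ℝ) p μ ν = 0) : μ = ν := by
  have hp0 : 0 < p := zero_lt_one.trans_le hp
  have hLP : levyProkhorovEDist (μ : Measure E) ν = 0 := by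
    refine le_antisymm (levyProkhorovEDist_le_of_forall_le _ _ 0 fun ε B hε hε' hB => ?_) zero_le
    -- A cost below `ε ^ p * ε` is what Markov needs to give mass at most `ε` to the pairs at
    -- distance at least `ε`.
    have hc : (0 : ℝ≥0∞) < (ε ^ p * ε) ^ (1 / p) :=
      ENNReal.rpow_pos (ENNReal.mul_pos (ENNReal.rpow_pos hε hε'.ne).ne' hε.ne')
        (ENNReal.mul_ne_top (ENNReal.rpow_ne_top_of_nonneg hp0.le hε'.ne) hε'.ne)
    rw [← h] at hc
    obtain ⟨γ, hγ, hlt⟩ := exists_mem_couplings_of_wasserstein_lt hc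
    rw [ENNReal.rpow_lt_rpow_iff (by positivity)] at hlt
    have hmeas : Measurable fun z : E × E => ENNReal.ofReal (dist z.1 z.2) ^ p := by fun_prop
    have hfar : (γ : Measure (E × E)) {z | ε ^ p ≤ ENNReal.ofReal (dist z.1 z.2) ^ p} ≤ ε := by
      have hM := mul_meas_ge_le_lintegral (μ := (γ : Measure (E × E))) hmeas (ε ^ p)
      have hne : ε ^ p ≠ 0 := (ENNReal.rpow_pos hε hε'.ne).ne'
      have hnt : ε ^ p ≠ ∞ := ENNReal.rpow_ne_top_of_nonneg hp0.le hε'.ne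
      exact (ENNReal.mul_le_mul_iff_right hne hnt).1 (hM.trans hlt.le)
    have hT : MeasurableSet (Metric.thickening ε.toReal B) := Metric.isOpen_thickening.measurableSet
    rw [← hγ.1, ← hγ.2, Measure.map_apply measurable_fst hB, Measure.map_apply measurable_snd hT]
    refine (measure_mono ?_).trans ((measure_union_le _ _).trans (add_le_add_right hfar _))
    intro z hz
    by_cases hd : ε ^ p ≤ ENNReal.ofReal (dist z.1 z.2) ^ p
    · exact Or.inr hd
    · left
      rw [not_le, ENNReal.rpow_lt_rpow_iff hp0, ← ENNReal.ofReal_toReal hε'.ne,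
        ENNReal.ofReal_lt_ofReal_iff (ENNReal.toReal_pos hε.ne' hε'.ne)] at hd
      exact Metric.mem_thickening_iff.2 ⟨z.1, hz, by rwa [dist_comm]⟩
  refine Subtype.ext (?_ : (μ : Measure E) = ν)
  refine ext_of_generate_finite _ ?_ isPiSystem_isClosed (fun A hA => ?_) (by simp)
  · rw [BorelSpace.measurable_eq (α := E), borel_eq_generateFrom_isClosed]
  · exact measure_eq_measure_of_levyProkhorovEDist_eq_zero_of_isClosed hLP hA
      ⟨1, one_pos, measure_ne_top _ _⟩ ⟨1, one_pos, measure_ne_top _ _⟩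

theorem wasserstein_dist_ne_top [BoundedSpace E] {p : ℝ} (hp : 1 ≤ p)
    (μ ν : ProbabilityMeasure E) : wasserstein (dist : E → E → ℝ) p μ ν ≠ ∞ := by
  obtain ⟨D, hD⟩ := exists_dist_le (E := E)
  exact ne_top_of_le_ne_top ENNReal.ofReal_ne_top (wasserstein_le_ofReal hD hp μ ν)

theorem isMetricFun_wassersteinReal [BorelSpace E] [PolishSpace E] [BoundedSpace E] {p : ℝ}
    (hp : 1 ≤ p) : IsMetricFun (wassersteinReal E p) where
  eq_zero_iff μ ν := by
    constructor
    · intro h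
      rcases (ENNReal.toReal_eq_zero_iff _).1 h with h | h
      · exact eq_of_wasserstein_dist_eq_zero hp h
      · exact absurd h (wasserstein_dist_ne_top hp μ ν)
    · rintro rfl
      simp [wassersteinReal, wasserstein_self measurable_dist dist_self hp μ]
  symm μ ν := by
    rw [wassersteinReal, wasserstein_comm measurable_dist dist_comm, wassersteinReal]
  triangle μ ν ρ := by
    rw [wassersteinReal, wassersteinReal, wassersteinReal,
      ← ENNReal.toReal_add (wasserstein_dist_ne_top hp _ _) (wasserstein_dist_ne_top hp _ _)]
    exact ENNReal.toReal_mono (ENNReal.add_ne_top.2 ⟨wasserstein_dist_ne_top hp _ _,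
      wasserstein_dist_ne_top hp _ _⟩)
      (wasserstein_triangle measurable_dist (fun _ _ => dist_nonneg) dist_triangle hp μ ν ρ)

end Metric

/-! ### Sampling from a finite exchangeable population -/

section Sampling

variable {E : Type*} [MeasurableSpace E]

theorem measurable_comp_index {ι κ : Type*} (e : ι → κ) :
    Measurable fun (x : κ → E) (j : ι) => x (e j) :=
  measurable_pi_lambda _ fun j => measurable_pi_apply (e j)

/-- The symmetric group is multiply transitive, so some permutation carries the first `n`
coordinates to the chosen ones; symmetry and compatibility then apply. -/
theorem IsCompatibleSymmetric.map_comp_injective {f : ∀ N : ℕ, ProbabilityMeasure (Fin N → E)}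
    (hf : IsCompatibleSymmetric f) {n K : ℕ} (hn : 1 ≤ n) {i : Fin n → Fin K}
    (hi : Function.Injective i) :
    (f K : Measure (Fin K → E)).map (fun x j => x (i j)) = (f n : Measure (Fin n → E)) := by
  have hnK : n ≤ K := by simpa using Fintype.card_le_of_injective i hi
  have := Equiv.Perm.isMultiplyPretransitive (Fin K) n
  obtain ⟨σ, hσ⟩ := MulAction.exists_smul_eq (Equiv.Perm (Fin K)) (Fin.castLEEmb hnK)
    (⟨i, hi⟩ : Fin n ↪ Fin K)
  have hσ' : ∀ j, σ (Fin.castLE hnK j) = i j := fun j => DFunLike.congr_fun hσ j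
  conv_rhs => rw [← hf.compatible n K hnK hn, ← hf.symmetric K (hn.trans hnK) σ,
    Measure.map_map (measurable_comp_index _) (measurable_comp_index _)]
  congr 1
  ext x j
  simp [hσ']

theorem pi_map_comp_injective {ι κ : Type*} [Fintype ι] [Fintype κ] (μ : Measure E)
    [IsProbabilityMeasure μ] {e : ι → κ} (he : Function.Injective e) :
    (Measure.pi fun _ : κ => μ).map (fun x j => x (e j)) = Measure.pi fun _ : ι => μ := by
  have h := (ProbabilityTheory.iIndepFun_pi (μ := fun _ : κ => μ) (X := fun _ => id)
    fun _ => aemeasurable_id).precomp he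
  refine (ProbabilityTheory.iIndepFun.map_fun_eq_pi_map
    (fun j => (measurable_pi_apply (e j)).aemeasurable) h).trans ?_
  congr 1
  ext1 j
  exact (measurePreserving_eval (fun _ : κ => μ) (e j)).map_eq

/-- The uniform measure on `Fin K`. -/
noncomputable def uniformFin (K : ℕ) [NeZero K] : Measure (Fin K) :=
  (empiricalMeasure (id : Fin K → Fin K) : Measure (Fin K))

instance (K : ℕ) [NeZero K] : IsProbabilityMeasure (uniformFin K) := by
  unfold uniformFin; infer_instance

theorem map_uniformFin {K : ℕ} [NeZero K] (x : Fin K → E) :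
    (uniformFin K).map x = (empiricalMeasure x : Measure E) := by
  change ((K : ℝ≥0∞)⁻¹ • ∑ i, Measure.dirac (id i)).map x = (K : ℝ≥0∞)⁻¹ • ∑ i, Measure.dirac (x i)
  rw [Measure.map_smul, ← Measure.mapₗ_apply_of_measurable (measurable_of_finite x), map_sum]
  simp [Measure.mapₗ_apply_of_measurable (measurable_of_finite x),
    Measure.map_dirac' (measurable_of_finite x)]

theorem uniformFin_singleton {K : ℕ} [NeZero K] (k : Fin K) :
    uniformFin K {k} = (K : ℝ≥0∞)⁻¹ := by
  change ((K : ℝ≥0∞)⁻¹ • ∑ i, Measure.dirac (id i)) {k} = _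
  simp [Measure.finsetSum_apply, Set.indicator_apply]

/-- I.i.d. draws from an empirical measure are draws with replacement of uniform indices; this
separates the randomness of the indices from the population. -/
theorem pi_empiricalMeasure {K : ℕ} [NeZero K] (x : Fin K → E) (n : ℕ) :
    (Measure.pi fun _ : Fin n => (empiricalMeasure x : Measure E)) =
      (Measure.pi fun _ : Fin n => uniformFin K).map (fun i j => x (i j)) := by
  rw [← map_uniformFin]
  exact (Measure.pi_map_pi fun _ => (measurable_of_finite x).aemeasurable).symm

/-- The probability that `n` independent draws from `K` elements are distinct is at least
`((K + 1 - n) / K) ^ n`. -/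
theorem le_pi_uniformFin_injective (n K : ℕ) [NeZero K] :
    (((K + 1 - n : ℕ) : ℝ≥0∞) / K) ^ n ≤
      Measure.pi (fun _ : Fin n => uniformFin K) {i | Function.Injective i} := by
  classical
  -- Exact count: the injections among the `K ^ n` equally likely index maps.
  have h1 : Measure.pi (fun _ : Fin n => uniformFin K) {i | Function.Injective i} =
      (K.descFactorial n : ℝ≥0∞) * (K : ℝ≥0∞)⁻¹ ^ n := by
    have hc : (Finset.univ.filter fun i : Fin n → Fin K => Function.Injective i).card =
        K.descFactorial n := by
      rw [← Fintype.card_subtype, Fintype.card_congr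
        (Equiv.subtypeInjectiveEquivEmbedding (Fin n) (Fin K)), Fintype.card_embedding_eq,
        Fintype.card_fin, Fintype.card_fin]
    have hs : {i : Fin n → Fin K | Function.Injective i} =
        (Finset.univ.filter fun i : Fin n → Fin K => Function.Injective i) := by
      ext; simp
    rw [hs, ← sum_measure_singleton]
    simp [Measure.pi_singleton, uniformFin_singleton, hc]
  rw [h1, div_eq_mul_inv, mul_pow]
  gcongr
  exact_mod_cast Nat.pow_sub_le_descFactorial K n

theorem tendsto_injective_ratio (n : ℕ) :
    Tendsto (fun K : ℕ => (((K + 1 - n : ℕ) : ℝ≥0∞) / K) ^ n) atTop (𝓝 1) := by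
  have h : Tendsto (fun K : ℕ => 1 + (1 - n : ℝ) / K) atTop (𝓝 1) := by
    simpa using (tendsto_const_div_atTop_nhds_zero_nat (1 - n : ℝ)).const_add 1
  have h2 : Tendsto (fun K : ℕ => ((K + 1 - n : ℕ) : ℝ≥0∞) / K) atTop (𝓝 1) := by
    rw [← ENNReal.ofReal_one]
    refine (ENNReal.tendsto_ofReal h).congr' ?_
    filter_upwards [eventually_ge_atTop n, eventually_ge_atTop 1] with K hK hK1
    have hK0 : (0 : ℝ) < K := by exact_mod_cast hK1
    rw [← ENNReal.ofReal_natCast, ← ENNReal.ofReal_natCast (n := K), ← ENNReal.ofReal_div_of_pos hK0,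
      Nat.cast_sub (by omega)]
    congr 1
    push_cast
    field_simp
    ring
  simpa using ENNReal.Tendsto.pow (n := n) h2

theorem measurable_ofReal_rpow_comp {Ω X : Type*} [MeasurableSpace Ω] [MeasurableSpace X]
    {δ : X → X → ℝ} (hδ : Measurable (Function.uncurry δ)) (p : ℝ) {u v : Ω → X}
    (hu : Measurable u) (hv : Measurable v) :
    Measurable fun ω => ENNReal.ofReal (δ (u ω) (v ω)) ^ p :=
  (ENNReal.measurable_ofReal.comp (hδ.comp (hu.prodMk hv))).pow_const p

theorem measurable_apply_index {ι κ α : Type*} [Finite κ] [MeasurableSpace κ]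
    [MeasurableSingletonClass κ] [MeasurableSpace α] {x : α → κ → E} (hx : Measurable x)
    {i : α → ι → κ} (hi : Measurable i) (j : ι) : Measurable fun a => x a (i a j) := by
  have h : Measurable fun q : (κ → E) × κ => q.1 q.2 :=
    measurable_from_prod_countable_left fun k => measurable_pi_apply k
  exact h.comp (hx.prodMk ((measurable_pi_apply j).comp hi))

theorem iidError_rpow (δ : ProbabilityMeasure E → ProbabilityMeasure E → ℝ) {p : ℝ} (hp : 1 ≤ p)
    (N : ℕ) [NeZero N] (g : ProbabilityMeasure E) :
    iidError δ p N g ^ p = ∫⁻ x : Fin N → E, ENNReal.ofReal (δ (empiricalMeasure x) g) ^ p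
      ∂(Measure.pi fun _ : Fin N => (g : Measure E)) := by
  rw [iidError, one_div, ENNReal.rpow_inv_rpow (zero_lt_one.trans_le hp).ne']

/-- By Fubini, fix the population `x`: the block of draws selected by the injection `e` is again
i.i.d. with law `empiricalMeasure x`. -/
theorem lintegral_sampling_eq_iidError {δ : ProbabilityMeasure E → ProbabilityMeasure E → ℝ}
    (hδ : Measurable (Function.uncurry δ)) {p : ℝ} (hp : 1 ≤ p) {n M K : ℕ} [NeZero M] [NeZero K]
    {e : Fin M → Fin n} (he : Function.Injective e) (P : Measure (Fin K → E)) [SFinite P] :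
    ∫⁻ z : (Fin K → E) × (Fin n → Fin K),
        ENNReal.ofReal (δ (empiricalMeasure fun j => z.1 (z.2 (e j))) (empiricalMeasure z.1)) ^ p
        ∂P.prod (Measure.pi fun _ => uniformFin K) =
      ∫⁻ x, iidError δ p M (empiricalMeasure x) ^ p ∂P := by
  have hm : Measurable fun z : (Fin K → E) × (Fin n → Fin K) =>
      ENNReal.ofReal (δ (empiricalMeasure fun j => z.1 (z.2 (e j))) (empiricalMeasure z.1)) ^ p := by
    refine measurable_ofReal_rpow_comp hδ p (measurable_empiricalMeasure.comp
      (measurable_pi_lambda _ fun j => ?_)) (measurable_empiricalMeasure.comp measurable_fst)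
    exact measurable_apply_index measurable_fst measurable_snd (e j)
  rw [lintegral_prod _ hm.aemeasurable]
  refine lintegral_congr fun x => ?_
  rw [iidError_rpow δ hp, pi_empiricalMeasure, lintegral_map
    (measurable_ofReal_rpow_comp hδ p measurable_empiricalMeasure measurable_const)
    (measurable_of_finite _), ← pi_map_comp_injective (uniformFin K) he, lintegral_map
    (measurable_of_finite _) (measurable_comp_index e)]

/-- For each fixed injective choice of indices the sample has law `f n`, so integrating over these
choices gives the left side; the non-injective ones contribute a nonnegative amount and are dropped.
-/
theorem lintegral_mul_injective_le {f : ∀ N : ℕ, ProbabilityMeasure (Fin N → E)}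
    (hf : IsCompatibleSymmetric f) {n : ℕ} (hn : 1 ≤ n) (K : ℕ) [NeZero K]
    {Ψ : (Fin n → E) → ℝ≥0∞} (hΨ : Measurable Ψ) :
    Measure.pi (fun _ : Fin n => uniformFin K) {i | Function.Injective i} *
        ∫⁻ y, Ψ y ∂(f n : Measure (Fin n → E)) ≤
      ∫⁻ z : (Fin K → E) × (Fin n → Fin K), Ψ (fun j => z.1 (z.2 j))
        ∂(f K : Measure (Fin K → E)).prod (Measure.pi fun _ => uniformFin K) := by
  have hm : Measurable fun z : (Fin K → E) × (Fin n → Fin K) => Ψ fun j => z.1 (z.2 j) :=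
    hΨ.comp (measurable_pi_lambda _ fun j =>
      measurable_apply_index measurable_fst measurable_snd j)
  rw [lintegral_prod_symm _ hm.aemeasurable, mul_comm, ← setLIntegral_const]
  refine le_trans (setLIntegral_mono_ae' (Set.toFinite _).measurableSet
    (Eventually.of_forall fun i hi => ?_)) (setLIntegral_le_lintegral _ _)
  rw [← hf.map_comp_injective hn hi, lintegral_map hΨ (measurable_comp_index i)]

theorem empiricalLaw_eq_map {f : ∀ N : ℕ, ProbabilityMeasure (Fin N → E)}
    (hf : IsCompatibleSymmetric f) {n K : ℕ} [NeZero n] {i : Fin n → Fin K}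
    (hi : Function.Injective i) :
    (f K : Measure (Fin K → E)).map (fun x => empiricalMeasure fun j => x (i j)) =
      (empiricalLaw (f n) : Measure (ProbabilityMeasure E)) := by
  change _ = (f n : Measure (Fin n → E)).map empiricalMeasure
  rw [← hf.map_comp_injective NeZero.one_le hi,
    Measure.map_map measurable_empiricalMeasure (measurable_comp_index i)]
  rfl

/-- The distance between the laws of two empirical measures of an exchangeable sequence is
controlled by the error of sampling with replacement from finite populations. -/
theorem wasserstein_empiricalLaw_le {δ : ProbabilityMeasure E → ProbabilityMeasure E → ℝ}
    (hδ : IsMetricFun δ) (hδm : Measurable (Function.uncurry δ)) {p : ℝ} (hp : 1 ≤ p)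
    {f : ∀ N : ℕ, ProbabilityMeasure (Fin N → E)} (hf : IsCompatibleSymmetric f)
    {M N : ℕ} [NeZero M] [NeZero N] {a b : ℝ≥0∞}
    (ha : ∀ (K : ℕ) [NeZero K],
      ∫⁻ x, iidError δ p M (empiricalMeasure x) ^ p ∂(f K : Measure (Fin K → E)) ≤ a ^ p)
    (hb : ∀ (K : ℕ) [NeZero K],
      ∫⁻ x, iidError δ p N (empiricalMeasure x) ^ p ∂(f K : Measure (Fin K → E)) ≤ b ^ p) :
    wasserstein δ p (empiricalLaw (f M)) (empiricalLaw (f N)) ≤ a + b := by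
  have hp0 : 0 < p := zero_lt_one.trans_le hp
  have hnonneg : ∀ μ ν, 0 ≤ δ μ ν := fun μ ν => by
    have h1 := hδ.triangle μ ν μ
    rw [(hδ.eq_zero_iff μ μ).2 rfl, hδ.symm ν μ] at h1
    linarith
  have he₁ : Function.Injective (Fin.castAdd N : Fin M → Fin (M + N)) :=
    Fin.castAdd_injective M N
  have he₂ : Function.Injective (Fin.natAdd M : Fin N → Fin (M + N)) :=
    Fin.natAdd_injective N M
  have hMN : 1 ≤ M + N := le_add_right NeZero.one_le
  -- The coupling: two disjoint blocks of a single vector of length `M + N`.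
  let u : (Fin (M + N) → E) → ProbabilityMeasure E :=
    fun y => empiricalMeasure fun j => y (Fin.castAdd N j)
  let v : (Fin (M + N) → E) → ProbabilityMeasure E :=
    fun y => empiricalMeasure fun j => y (Fin.natAdd M j)
  have hu : Measurable u := measurable_empiricalMeasure.comp (measurable_comp_index _)
  have hv : Measurable v := measurable_empiricalMeasure.comp (measurable_comp_index _)
  have hΨ := measurable_ofReal_rpow_comp hδm p hu hv
  refine (wasserstein_le_of_map_eq hδm p hu hv (empiricalLaw_eq_map hf he₁)
    (empiricalLaw_eq_map hf he₂)).trans ?_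
  rw [one_div, ENNReal.rpow_inv_le_iff hp0]
  have hK : ∀ K : ℕ, 1 ≤ K → (((K + 1 - (M + N) : ℕ) : ℝ≥0∞) / K) ^ (M + N) *
      ∫⁻ y, ENNReal.ofReal (δ (u y) (v y)) ^ p ∂(f (M + N) : Measure (Fin (M + N) → E)) ≤
        (a + b) ^ p := by
    intro K hK1
    have : NeZero K := ⟨by omega⟩
    refine (mul_le_mul_left (le_pi_uniformFin_injective (M + N) K) _).trans ?_
    refine (lintegral_mul_injective_le hf hMN K hΨ).trans ?_
    rw [← ENNReal.rpow_inv_le_iff hp0, ← one_div]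
    have hidx : ∀ j, Measurable fun z : (Fin K → E) × (Fin (M + N) → Fin K) => z.1 (z.2 j) :=
      fun j => measurable_apply_index measurable_fst measurable_snd j
    have hsample : Measurable fun z : (Fin K → E) × (Fin (M + N) → Fin K) => fun j => z.1 (z.2 j) :=
      measurable_pi_lambda _ hidx
    have hpop : Measurable fun z : (Fin K → E) × (Fin (M + N) → Fin K) => empiricalMeasure z.1 :=
      measurable_empiricalMeasure.comp measurable_fst
    have hF : Measurable fun z : (Fin K → E) × (Fin (M + N) → Fin K) =>
        ENNReal.ofReal (δ (u fun j => z.1 (z.2 j)) (empiricalMeasure z.1)) :=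
      ENNReal.measurable_ofReal.comp (hδm.comp ((hu.comp hsample).prodMk hpop))
    have hG : Measurable fun z : (Fin K → E) × (Fin (M + N) → Fin K) =>
        ENNReal.ofReal (δ (v fun j => z.1 (z.2 j)) (empiricalMeasure z.1)) :=
      ENNReal.measurable_ofReal.comp (hδm.comp ((hv.comp hsample).prodMk hpop))
    -- The population's empirical measure is the intermediate point of the triangle inequality.
    refine le_trans (le_trans ?_
      (ENNReal.lintegral_Lp_add_le
        (μ := (f K : Measure (Fin K → E)).prod (Measure.pi fun _ => uniformFin K))
        hF.aemeasurable hG.aemeasurable hp)) (add_le_add ?_ ?_)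
    · gcongr with z
      simp only [Pi.add_apply]
      rw [← ENNReal.ofReal_add (hnonneg _ _) (hnonneg _ _),
        hδ.symm (v fun j => z.1 (z.2 j))]
      exact ENNReal.ofReal_le_ofReal (hδ.triangle _ _ _)
    · rw [one_div, ENNReal.rpow_inv_le_iff hp0]
      exact (lintegral_sampling_eq_iidError hδm hp he₁ _).trans_le (ha K)
    · rw [one_div, ENNReal.rpow_inv_le_iff hp0]
      exact (lintegral_sampling_eq_iidError hδm hp he₂ _).trans_le (hb K)
  -- The right side of `hK` does not involve `K`, while the probability factor tends to one.
  refine le_of_tendsto ?_ ((eventually_ge_atTop 1).mono hK)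
  simpa using ENNReal.Tendsto.mul_const (tendsto_injective_ratio (M + N)) (Or.inl one_ne_zero)

/-- The error hypothesis is averaged over `f K` rather than pointwise in `x`, because a rate
depending on the one-particle law is available only on average. -/
theorem wasserstein_empiricalLaw_le_of_rate
    {δ : ProbabilityMeasure E → ProbabilityMeasure E → ℝ}
    (hδ : IsMetricFun δ) (hδm : Measurable (Function.uncurry δ)) {p : ℝ} (hp : 1 ≤ p)
    {f : ∀ N : ℕ, ProbabilityMeasure (Fin N → E)} (hf : IsCompatibleSymmetric f)
    {ε : ℕ → ℝ} (hε : IsRate ε)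
    (h : ∀ (N K : ℕ) [NeZero N] [NeZero K], ∫⁻ x, iidError δ p N (empiricalMeasure x) ^ p
      ∂(f K : Measure (Fin K → E)) ≤ ENNReal.ofReal (ε N) ^ p)
    {M N : ℕ} [NeZero M] [NeZero N] (hMN : M ≤ N) :
    wasserstein δ p (empiricalLaw (f M)) (empiricalLaw (f N)) ≤ ENNReal.ofReal (ε M + ε N) ∧
      (AntitoneOn ε (Set.Ici 1) →
        wasserstein δ p (empiricalLaw (f M)) (empiricalLaw (f N)) ≤ ENNReal.ofReal (2 * ε M)) := by
  have h1 : wasserstein δ p (empiricalLaw (f M)) (empiricalLaw (f N)) ≤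
      ENNReal.ofReal (ε M + ε N) := by
    rw [ENNReal.ofReal_add (hε.pos M NeZero.one_le).le (hε.pos N NeZero.one_le).le]
    exact wasserstein_empiricalLaw_le hδ hδm hp hf (fun K _ => h M K) fun K _ => h N K
  refine ⟨h1, fun hanti => h1.trans (ENNReal.ofReal_le_ofReal ?_)⟩
  have := hanti (Set.mem_Ici.2 (NeZero.one_le : 1 ≤ M)) (Set.mem_Ici.2 (NeZero.one_le : 1 ≤ N)) hMN
  linarith

end Sampling

/-! ### Uniform laws of large numbers at empirical measures -/

theorem hasFiniteMoment_empiricalMeasure {E : Type*} [MetricSpace E] [MeasurableSpace E]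
    [OpensMeasurableSpace E] {p : ℝ} (hp : 1 ≤ p) {K : ℕ} [NeZero K] (x : Fin K → E) :
    HasFiniteMoment p (empiricalMeasure x) := by
  have hp0 : 0 ≤ p := zero_le_one.trans hp
  refine ⟨x 0, ?_⟩
  have hm : Measurable fun y => ENNReal.ofReal (dist y (x 0)) ^ p := by fun_prop
  rw [← map_uniformFin, lintegral_map hm (measurable_of_finite x), lintegral_fintype]
  exact ENNReal.sum_lt_top.2 fun i _ => ENNReal.mul_lt_top
    (ENNReal.rpow_lt_top_of_nonneg hp0 ENNReal.ofReal_ne_top) (measure_lt_top _ _)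

theorem UniformLLN.lintegral_iidError_le {E : Type*} [MetricSpace E] [MeasurableSpace E]
    [OpensMeasurableSpace E] {δ : ProbabilityMeasure E → ProbabilityMeasure E → ℝ} {p : ℝ}
    (hp : 1 ≤ p) {ε : ℕ → ℝ} (h : UniformLLN δ p ε) (N K : ℕ) [NeZero N] [NeZero K]
    (P : Measure (Fin K → E)) [IsProbabilityMeasure P] :
    ∫⁻ x, iidError δ p N (empiricalMeasure x) ^ p ∂P ≤ ENNReal.ofReal (ε N) ^ p := by
  have hp0 : 0 ≤ p := zero_le_one.trans hp
  calc _ ≤ ∫⁻ _, ENNReal.ofReal (ε N) ^ p ∂P := by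
        gcongr with x
        exact h.bound N _ (hasFiniteMoment_empiricalMeasure hp x)
    _ = _ := by simp

/-! ### Transport bounds from partial couplings and cells -/

section Completion

variable {X : Type*} [MeasurableSpace X]

/-- A partial coupling of two probability measures extends to a coupling; the mass which is added
costs at most `D` per unit. -/
theorem wasserstein_rpow_le_of_partial_coupling {δ : X → X → ℝ}
    {D p : ℝ} (hD : ∀ x y, δ x y ≤ D) (hp : 1 ≤ p)
    {μ ν : ProbabilityMeasure X} (γ : Measure (X × X)) [IsFiniteMeasure γ]
    (hμ : γ.map Prod.fst ≤ μ) (hν : γ.map Prod.snd ≤ ν) :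
    wasserstein δ p μ ν ^ p ≤ ∫⁻ z, ENNReal.ofReal (δ z.1 z.2) ^ p ∂γ +
      ENNReal.ofReal D ^ p * (1 - γ Set.univ) := by
  have hp0 : 0 < p := zero_lt_one.trans_le hp
  set μ' : Measure X := (μ : Measure X) - γ.map Prod.fst with hμ'
  set ν' : Measure X := (ν : Measure X) - γ.map Prod.snd with hν'
  set r : ℝ≥0∞ := 1 - γ Set.univ with hr
  have hr_top : r ≠ ∞ := ENNReal.sub_ne_top ENNReal.one_ne_top
  have hμu : μ' Set.univ = r := by
    rw [hμ', Measure.sub_apply MeasurableSet.univ hμ, Measure.map_apply measurable_fst .univ]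
    simp [hr]
  have hνu : ν' Set.univ = r := by
    rw [hν', Measure.sub_apply MeasurableSet.univ hν, Measure.map_apply measurable_snd .univ]
    simp [hr]
  have hle : γ Set.univ ≤ 1 := by
    have := hμ Set.univ
    rw [Measure.map_apply measurable_fst .univ, Set.preimage_univ] at this
    exact this.trans prob_le_one
  -- If `r = 0`, then `r⁻¹ = ∞` and `r⁻¹ * r = 0`, but `m` vanishes as well.
  have hinv : ∀ (m : Measure X), m Set.univ = r → (r⁻¹ * r) • m = m := by
    intro m hm
    rcases eq_or_ne r 0 with h0 | h0
    · rw [h0, Measure.measure_univ_eq_zero] at hm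
      simp [hm]
    · rw [ENNReal.inv_mul_cancel h0 hr_top, one_smul]
  -- Both residual marginals have mass `r`, so their product divided by `r` supplies exactly the
  -- missing marginals.
  let Γ : Measure (X × X) := γ + r⁻¹ • μ'.prod ν'
  have hfst : Γ.map Prod.fst = (μ : Measure X) := by
    rw [Measure.map_add _ _ measurable_fst, Measure.map_smul, Measure.map_fst_prod, hνu, smul_smul,
      hinv _ hμu, add_comm]
    exact Measure.sub_add_cancel_of_le hμ
  have hsnd : Γ.map Prod.snd = (ν : Measure X) := by
    rw [Measure.map_add _ _ measurable_snd, Measure.map_smul, Measure.map_snd_prod, hμu, smul_smul,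
      hinv _ hνu, add_comm]
    exact Measure.sub_add_cancel_of_le hν
  have hΓ : IsProbabilityMeasure Γ := by
    constructor
    have h1 : Γ.map Prod.fst Set.univ = 1 := by rw [hfst, measure_univ]
    rwa [Measure.map_apply measurable_fst .univ] at h1
  have hw := wasserstein_le_of_mem_couplings δ p (μ := μ) (ν := ν) (γ := ⟨Γ, hΓ⟩) ⟨hfst, hsnd⟩
  rw [one_div, ENNReal.le_rpow_inv_iff hp0] at hw
  refine hw.trans ?_
  change ∫⁻ z, _ ∂Γ ≤ _
  rw [lintegral_add_measure, lintegral_smul_measure]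
  gcongr
  calc r⁻¹ • ∫⁻ z, ENNReal.ofReal (δ z.1 z.2) ^ p ∂(μ'.prod ν')
      ≤ r⁻¹ • ∫⁻ _, ENNReal.ofReal D ^ p ∂(μ'.prod ν') := by
        gcongr; exact hD _ _
    _ = ENNReal.ofReal D ^ p * (r⁻¹ * r * r) := by
        rw [lintegral_const, ← Set.univ_prod_univ, Measure.prod_prod, hμu, hνu, smul_eq_mul]
        ring
    _ ≤ ENNReal.ofReal D ^ p * r := by
        gcongr
        calc r⁻¹ * r * r ≤ 1 * r := by gcongr; exact ENNReal.inv_mul_le_one r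
          _ = r := one_mul r

end Completion

section Partition

variable {E : Type*} [MetricSpace E] [MeasurableSpace E]

/-- Comparison of two probability measures on a bounded space through the masses of finitely many
small disjoint sets. -/
theorem wasserstein_rpow_le_partition [OpensMeasurableSpace E] [SecondCountableTopology E]
    {D p η : ℝ} (hD : ∀ x y : E, dist x y ≤ D) (hp : 1 ≤ p)
    {ι : Type*} (s : Finset ι) {A : ι → Set E} (hA : ∀ i ∈ s, MeasurableSet (A i))
    (hdisj : Set.PairwiseDisjoint (s : Set ι) A)
    (hη : ∀ i ∈ s, ∀ x ∈ A i, ∀ y ∈ A i, dist x y ≤ η) (μ ν : ProbabilityMeasure E) :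
    wasserstein (dist : E → E → ℝ) p μ ν ^ p ≤ ENNReal.ofReal η ^ p +
      ENNReal.ofReal D ^ p * ((ν : Measure E) (⋃ i ∈ s, A i)ᶜ +
        ∑ i ∈ s, ((ν : Measure E) (A i) - (μ : Measure E) (A i))) := by
  let a : ι → ℝ≥0∞ := fun i => (μ : Measure E) (A i)
  let b : ι → ℝ≥0∞ := fun i => (ν : Measure E) (A i)
  have ha : ∀ i, a i ≠ ∞ := fun i => measure_ne_top _ _
  have hb : ∀ i, b i ≠ ∞ := fun i => measure_ne_top _ _
  have hmass : ∀ i, (max (a i) (b i))⁻¹ * (a i * b i) = min (a i) (b i) := by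
    intro i
    rw [← max_mul_min (a i) (b i), ← mul_assoc]
    rcases eq_or_ne (max (a i) (b i)) 0 with h0 | h0
    · have : a i = 0 := le_antisymm (h0 ▸ le_max_left _ _) zero_le
      simp [this]
    · rw [ENNReal.inv_mul_cancel h0 (max_ne_top (ha i) (hb i)), one_mul]
  -- Inside each cell couple as much mass as possible: dividing the product of the restrictions by
  -- the larger mass leaves the total `min (a i) (b i)` and keeps both marginals below `μ` and `ν`.
  let γ : Measure (E × E) := ∑ i ∈ s, (max (a i) (b i))⁻¹ •
    ((μ : Measure E).restrict (A i)).prod ((ν : Measure E).restrict (A i))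
  have hγu : γ Set.univ = ∑ i ∈ s, min (a i) (b i) := by
    simp only [γ, Measure.finsetSum_apply, Measure.smul_apply, smul_eq_mul]
    refine Finset.sum_congr rfl fun i _ => ?_
    rw [← Set.univ_prod_univ, Measure.prod_prod, Measure.restrict_apply_univ,
      Measure.restrict_apply_univ, hmass]
  have hrestr : ∀ (m : Measure E) (u : Set E), MeasurableSet u →
      ∑ i ∈ s, m.restrict (A i) u ≤ m u := by
    intro m u hu
    calc ∑ i ∈ s, m.restrict (A i) u = m (⋃ i ∈ s, u ∩ A i) := by
          rw [measure_biUnion_finset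
            (fun i hi j hj hij => (hdisj hi hj hij).mono Set.inter_subset_right
              Set.inter_subset_right) fun i hi => hu.inter (hA i hi)]
          exact Finset.sum_congr rfl fun i _ => Measure.restrict_apply hu
      _ ≤ m u := measure_mono (Set.iUnion₂_subset fun i _ => Set.inter_subset_left)
  have hinv : ∀ c d : ℝ≥0∞, c ≤ d → d⁻¹ * c ≤ 1 := fun c d h =>
    (mul_le_mul_right h _).trans (ENNReal.inv_mul_le_one d)
  have hμ : γ.map Prod.fst ≤ μ := by
    refine Measure.le_iff.2 fun u hu => ?_
    rw [Measure.map_apply measurable_fst hu]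
    refine le_trans ?_ (hrestr μ u hu)
    simp only [γ, Measure.finsetSum_apply, Measure.smul_apply, smul_eq_mul]
    refine Finset.sum_le_sum fun i _ => ?_
    rw [← Set.prod_univ, Measure.prod_prod, Measure.restrict_apply_univ (μ := (ν : Measure E)),
      mul_comm _ ((ν : Measure E) (A i)), ← mul_assoc]
    exact mul_le_of_le_one_left zero_le (hinv _ _ (le_max_right _ _))
  have hν : γ.map Prod.snd ≤ ν := by
    refine Measure.le_iff.2 fun u hu => ?_
    rw [Measure.map_apply measurable_snd hu]
    refine le_trans ?_ (hrestr ν u hu)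
    simp only [γ, Measure.finsetSum_apply, Measure.smul_apply, smul_eq_mul]
    refine Finset.sum_le_sum fun i _ => ?_
    rw [← Set.univ_prod, Measure.prod_prod, Measure.restrict_apply_univ (μ := (μ : Measure E)),
      ← mul_assoc]
    exact mul_le_of_le_one_left zero_le (hinv _ _ (le_max_left _ _))
  have hγ1 : γ Set.univ ≤ 1 := by
    have := hμ Set.univ
    rw [Measure.map_apply measurable_fst .univ, Set.preimage_univ] at this
    exact this.trans prob_le_one
  have : IsFiniteMeasure γ := ⟨hγ1.trans_lt ENNReal.one_lt_top⟩
  refine (wasserstein_rpow_le_of_partial_coupling hD hp γ hμ hν).trans (add_le_add ?_ ?_)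
  · calc ∫⁻ z, ENNReal.ofReal (dist z.1 z.2) ^ p ∂γ
        ≤ ∫⁻ _, ENNReal.ofReal η ^ p ∂γ := by
          simp only [γ]
          rw [lintegral_finsetSum_measure, lintegral_finsetSum_measure]
          refine Finset.sum_le_sum fun i hi => ?_
          rw [lintegral_smul_measure, lintegral_smul_measure, Measure.prod_restrict]
          gcongr ?_ • ?_
          refine setLIntegral_mono' ((hA i hi).prod (hA i hi)) fun z hz => ?_
          gcongr
          exact hη i hi _ hz.1 _ hz.2
      _ ≤ ENNReal.ofReal η ^ p * 1 := by rw [lintegral_const]; gcongr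
      _ = _ := mul_one _
  · gcongr
    rw [hγu, tsub_le_iff_right, add_assoc, ← Finset.sum_add_distrib]
    calc (1 : ℝ≥0∞) = (ν : Measure E) (⋃ i ∈ s, A i)ᶜ + (ν : Measure E) (⋃ i ∈ s, A i) := by
          rw [add_comm, measure_add_measure_compl (Finset.measurableSet_biUnion s hA), measure_univ]
      _ ≤ _ := by
          rw [measure_biUnion_finset hdisj hA]
          gcongr with i hi
          rcases le_total (a i) (b i) with h | h
          · rw [min_eq_left h]; exact le_tsub_add
          · rw [min_eq_right h]; exact le_add_self

end Partition

/-! ### Empirical frequencies and the i.i.d. error of `W_p` -/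

theorem empiricalMeasure_apply_eq_ofReal {E : Type*} [MeasurableSpace E] {N : ℕ} [NeZero N]
    (x : Fin N → E) {A : Set E} (hA : MeasurableSet A) :
    (empiricalMeasure x : Measure E) A =
      ENNReal.ofReal ((∑ i, A.indicator (1 : E → ℝ) (x i)) / N) := by
  have hN : (0 : ℝ) < N := by exact_mod_cast Nat.pos_of_ne_zero (NeZero.ne N)
  have hnn : ∀ i, 0 ≤ A.indicator (1 : E → ℝ) (x i) := fun i =>
    Set.indicator_nonneg (fun _ _ => zero_le_one) _
  change ((N : ℝ≥0∞)⁻¹ • ∑ i, Measure.dirac (x i)) A = _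
  rw [ENNReal.ofReal_div_of_pos hN, ENNReal.ofReal_sum_of_nonneg fun i _ => hnn i,
    ENNReal.ofReal_natCast, ENNReal.div_eq_inv_mul]
  simp only [Measure.smul_apply, Measure.finsetSum_apply, smul_eq_mul, Measure.dirac_apply' _ hA]
  congr 1
  refine Finset.sum_congr rfl fun i _ => ?_
  by_cases hi : x i ∈ A <;> simp [hi]

/-- The mean deviation of the empirical frequency of a set from its probability. -/
theorem lintegral_sub_empiricalMeasure_le {E : Type*} [MeasurableSpace E] (h : ProbabilityMeasure E)
    (N : ℕ) [NeZero N] {A : Set E} (hA : MeasurableSet A) :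
    ∫⁻ x : Fin N → E, ((h : Measure E) A - (empiricalMeasure x : Measure E) A)
      ∂(Measure.pi fun _ : Fin N => (h : Measure E)) ≤ ENNReal.ofReal (1 / √N) := by
  have hN : (0 : ℝ) < N := by exact_mod_cast Nat.pos_of_ne_zero (NeZero.ne N)
  have hs : 0 < √(N : ℝ) := Real.sqrt_pos.2 hN
  have hss : √(N : ℝ) * √(N : ℝ) = N := Real.mul_self_sqrt hN.le
  set P : Measure (Fin N → E) := Measure.pi fun _ : Fin N => (h : Measure E)
  set χ : E → ℝ := A.indicator 1 with hχ
  have hχm : Measurable χ := measurable_one.indicator hA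
  have hχ01 : ∀ y, χ y ∈ Set.Icc (0 : ℝ) 1 := fun y => by
    by_cases hy : y ∈ A <;> simp [hχ, hy]
  have hχL : MemLp χ 2 (h : Measure E) :=
    MemLp.of_bound hχm.aestronglyMeasurable 1 (Eventually.of_forall fun y => by
      rw [Real.norm_of_nonneg (hχ01 y).1]; exact (hχ01 y).2)
  let S : (Fin N → E) → ℝ := ∑ i, fun x => χ (x i)
  have hSapply : ∀ x, S x = ∑ i, χ (x i) := fun x => by simp [S]
  have hSL : MemLp S 2 P := memLp_finsetSum' _ fun i _ =>
    hχL.comp_measurePreserving (measurePreserving_eval (fun _ : Fin N => (h : Measure E)) i)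
  have hmean : ∫ x, S x ∂P = N * (h : Measure E).real A := by
    have : ∀ i : Fin N, ∫ x, χ (x i) ∂P = (h : Measure E).real A := by
      intro i
      have hmp := measurePreserving_eval (fun _ : Fin N => (h : Measure E)) i
      rw [← integral_indicator_one hA, ← hmp.map_eq,
        integral_map hmp.measurable.aemeasurable hχm.aestronglyMeasurable]
    simp only [hSapply]
    have hi : ∀ i : Fin N, Integrable (fun x => χ (x i)) P := fun i =>
      (hχL.comp_measurePreserving
        (measurePreserving_eval (fun _ : Fin N => (h : Measure E)) i)).integrable one_le_two
    rw [integral_finsetSum _ fun i _ => hi i]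
    simp [this]
  have hvar : ∫ x, (S x - N * (h : Measure E).real A) ^ 2 ∂P ≤ N := by
    rw [← hmean, ← ProbabilityTheory.variance_eq_integral hSL.aestronglyMeasurable.aemeasurable,
      ProbabilityTheory.variance_sum_pi (μ := fun _ : Fin N => (h : Measure E)) fun _ => hχL]
    -- The variance of an indicator is at most `1 / 4`; the cruder bound `1` suffices.
    have hv := ProbabilityTheory.variance_le_sq_of_bounded
      (Eventually.of_forall hχ01 : ∀ᵐ y ∂(h : Measure E), χ y ∈ Set.Icc (0 : ℝ) 1)
      hχm.aemeasurable
    calc _ ≤ ∑ _ : Fin N, (1 : ℝ) := Finset.sum_le_sum fun _ _ => by linarith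
      _ = N := by simp
  have hint : Integrable (fun x => (S x - N * (h : Measure E).real A) ^ 2) P :=
    (hSL.sub (memLp_const _)).integrable_sq
  -- AM–GM replaces the deviation by a quadratic majorant, `2 |y| ≤ √N + y ^ 2 / √N`, so the
  -- variance bound applies directly and the mean is at most `(√N + √N) / (2 * N) = 1 / √N`.
  let q : (Fin N → E) → ℝ :=
    fun x => (√N + (S x - N * (h : Measure E).real A) ^ 2 / √N) / (2 * N)
  have hq : Integrable q P := ((integrable_const _).add (hint.div_const _)).div_const _
  have hqint : ∫ x, q x ∂P ≤ 1 / √N := by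
    simp only [q]
    rw [integral_div, integral_add (integrable_const _) (hint.div_const _), integral_div,
      integral_const]
    simp only [probReal_univ, one_smul]
    rw [div_le_div_iff₀ (by positivity) hs]
    calc (√N + (∫ x, (S x - N * (h : Measure E).real A) ^ 2 ∂P) / √N) * √N
        = √N * √N + ∫ x, (S x - N * (h : Measure E).real A) ^ 2 ∂P := by field_simp
      _ ≤ 1 * (2 * N) := by linarith
  have hq0 : ∀ x, 0 ≤ q x := fun x => by positivity
  refine le_trans (lintegral_mono fun x => ?_)
    ((ofReal_integral_eq_lintegral_ofReal hq (Eventually.of_forall hq0)).symm.trans_le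
      (ENNReal.ofReal_le_ofReal hqint))
  rw [empiricalMeasure_apply_eq_ofReal x hA, ← ofReal_measureReal,
    ← ENNReal.ofReal_sub _ (div_nonneg (Finset.sum_nonneg fun i _ => (hχ01 _).1) hN.le)]
  refine ENNReal.ofReal_le_ofReal ?_
  change _ - (∑ i, χ (x i)) / N ≤ q x
  rw [← hSapply]
  simp only [q]
  set y := S x - N * (h : Measure E).real A with hy
  have h1 : (h : Measure E).real A - S x / N = -y / N := by rw [hy]; field_simp; ring
  rw [h1, div_le_div_iff₀ hN (by positivity)]
  have h2 : -y * 2 ≤ √N + y ^ 2 / √N := by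
    rw [← sub_nonneg]
    have : √N + y ^ 2 / √N - -y * 2 = (√N + y) ^ 2 / √N := by field_simp; ring
    rw [this]; positivity
  nlinarith

/-- The bound on the mean `p`-th power of the Wasserstein distance between an empirical measure of
`N` points and the underlying law which is given by `m` cells of diameter `η` covering all but a
mass `η`, when the diameter of the space is at most `D`. -/
noncomputable def cellBound (D p η : ℝ) (m N : ℕ) : ℝ≥0∞ :=
  ENNReal.ofReal η ^ p + ENNReal.ofReal D ^ p * (ENNReal.ofReal η + m * ENNReal.ofReal (1 / √N))

theorem ofReal_wassersteinReal {E : Type*} [MetricSpace E] [MeasurableSpace E] [BoundedSpace E]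
    {p : ℝ} (hp : 1 ≤ p) (μ ν : ProbabilityMeasure E) :
    ENNReal.ofReal (wassersteinReal E p μ ν) = wasserstein (dist : E → E → ℝ) p μ ν :=
  ENNReal.ofReal_toReal (wasserstein_dist_ne_top hp μ ν)

/-- The uncovered mass of `h` is kept explicit: the bound is affine in `h`, so it can be averaged
when `h` is itself a random empirical measure. -/
theorem iidError_wassersteinReal_rpow_le {E : Type*} [MetricSpace E] [MeasurableSpace E]
    [OpensMeasurableSpace E] [SecondCountableTopology E] [BoundedSpace E]
    {D p η : ℝ} (hD : ∀ x y : E, dist x y ≤ D) (hp : 1 ≤ p)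
    {A : ℕ → Set E} (hA : ∀ i, MeasurableSet (A i)) (hdisj : Pairwise (Function.onFun Disjoint A))
    (hη : ∀ i, ∀ x ∈ A i, ∀ y ∈ A i, dist x y ≤ η) (m N : ℕ) [NeZero N]
    (h : ProbabilityMeasure E) :
    iidError (wassersteinReal E p) p N h ^ p ≤ ENNReal.ofReal η ^ p + ENNReal.ofReal D ^ p *
      ((h : Measure E) (⋃ i ∈ Finset.range m, A i)ᶜ + m * ENNReal.ofReal (1 / √N)) := by
  have hp0 : 0 ≤ p := zero_le_one.trans hp
  rw [iidError_rpow _ hp]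
  have hmeas : ∀ i, Measurable fun x : Fin N → E =>
      (h : Measure E) (A i) - (empiricalMeasure x : Measure E) (A i) := fun i =>
    measurable_const.sub ((Measure.measurable_coe (hA i)).comp
      (measurable_subtype_coe.comp measurable_empiricalMeasure))
  calc _ ≤ ∫⁻ x : Fin N → E, (ENNReal.ofReal η ^ p + ENNReal.ofReal D ^ p *
          ((h : Measure E) (⋃ i ∈ Finset.range m, A i)ᶜ + ∑ i ∈ Finset.range m,
            ((h : Measure E) (A i) - (empiricalMeasure x : Measure E) (A i))))
          ∂(Measure.pi fun _ : Fin N => (h : Measure E)) := by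
        refine lintegral_mono fun x => ?_
        rw [ofReal_wassersteinReal hp]
        exact wasserstein_rpow_le_partition hD hp _ (fun i _ => hA i)
          (hdisj.set_pairwise _) (fun i _ => hη i) _ _
    _ ≤ _ := by
        rw [lintegral_add_left measurable_const, lintegral_const_mul' _ _
          (ENNReal.rpow_ne_top_of_nonneg hp0 ENNReal.ofReal_ne_top),
          lintegral_add_left measurable_const, lintegral_finsetSum _ fun i _ => hmeas i]
        simp only [lintegral_const, measure_univ, mul_one]
        gcongr
        calc _ ≤ ∑ i ∈ Finset.range m, ENNReal.ofReal (1 / √N) :=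
              Finset.sum_le_sum fun i _ => lintegral_sub_empiricalMeasure_le h N (hA i)
          _ = _ := by simp

/-! ### Small cells and the rates they produce -/

theorem exists_cells {E : Type*} [MetricSpace E] [SecondCountableTopology E] [Nonempty E]
    [MeasurableSpace E] [OpensMeasurableSpace E] {η : ℝ} (hη : 0 < η) :
    ∃ A : ℕ → Set E, (∀ i, MeasurableSet (A i)) ∧ Pairwise (Function.onFun Disjoint A) ∧
      (∀ i, ∀ x ∈ A i, ∀ y ∈ A i, dist x y ≤ η) ∧ ⋃ i, A i = Set.univ ∧
      (TotallyBounded (Set.univ : Set E) → ∃ m, ⋃ i ∈ Finset.range m, A i = Set.univ) := by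
  let x := TopologicalSpace.denseSeq E
  let B : ℕ → Set E := fun i => Metric.ball (x i) (η / 2)
  have hcover : ⋃ i, B i = Set.univ := by
    refine Set.eq_univ_of_forall fun y => Set.mem_iUnion.2 ?_
    obtain ⟨i, hi⟩ :=
      (TopologicalSpace.denseRange_denseSeq E).exists_dist_lt y (half_pos hη)
    exact ⟨i, hi⟩
  refine ⟨disjointed B, fun i => MeasurableSet.disjointed (fun i => Metric.isOpen_ball.measurableSet) i,
    disjoint_disjointed B, fun i y hy z hz => ?_, by rw [iUnion_disjointed, hcover], fun htb => ?_⟩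
  · have h1 := Metric.mem_ball.1 (disjointed_subset B i hy)
    have h2 := Metric.mem_ball.1 (disjointed_subset B i hz)
    have := dist_triangle_right y z (x i)
    linarith
  -- A finite `η / 4`-net, each of whose points is within `η / 4` of the dense sequence, shows that
  -- finitely many of the `η / 2`-balls cover; disjointing preserves the partial unions.
  · obtain ⟨t, ht, hsub⟩ := Metric.totallyBounded_iff.1 htb (η / 4) (by positivity)
    have hdense : ∀ y : E, ∃ i, dist y (x i) < η / 4 := fun y => by
      obtain ⟨i, hi⟩ :=
        (TopologicalSpace.denseRange_denseSeq E).exists_dist_lt y (show 0 < η / 4 by positivity)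
      exact ⟨i, hi⟩
    choose idx hidx using hdense
    refine ⟨ht.toFinset.sup idx + 1, Set.eq_univ_of_forall fun y => ?_⟩
    obtain ⟨c, hc, hyc⟩ := Set.mem_iUnion₂.1 (hsub (Set.mem_univ y))
    have hy : y ∈ B (idx c) := by
      have h1 := Metric.mem_ball.1 hyc
      have h2 := dist_triangle y c (x (idx c))
      have h3 := hidx c
      exact Metric.mem_ball.2 (by linarith)
    have hle : idx c ≤ ht.toFinset.sup idx := Finset.le_sup (ht.mem_toFinset.2 hc)
    have : y ∈ partialSups B (ht.toFinset.sup idx) := le_partialSups_of_le B hle hy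
    rw [← partialSups_disjointed] at this
    rw [partialSups_eq_biSup] at this
    simp only [Set.iSup_eq_iUnion, Set.mem_iUnion] at this ⊢
    obtain ⟨j, hj, hyj⟩ := this
    exact ⟨j, Finset.mem_range.2 (Nat.lt_succ_of_le hj), hyj⟩

theorem tendsto_cellBound (D : ℝ) {p : ℝ} (hp : 1 ≤ p) (η : ℝ) (m : ℕ) :
    Tendsto (cellBound D p η m) atTop
      (𝓝 (ENNReal.ofReal η ^ p + ENNReal.ofReal D ^ p * ENNReal.ofReal η)) := by
  have hp0 : 0 ≤ p := zero_le_one.trans hp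
  have h1 : Tendsto (fun N : ℕ => 1 / √(N : ℝ)) atTop (𝓝 0) := by
    simp only [one_div]
    exact (Real.tendsto_sqrt_atTop.comp tendsto_natCast_atTop_atTop).inv_tendsto_atTop
  have h2 : Tendsto (fun N : ℕ => (m : ℝ≥0∞) * ENNReal.ofReal (1 / √N)) atTop (𝓝 0) := by
    simpa using ENNReal.Tendsto.const_mul (ENNReal.tendsto_ofReal h1)
      (Or.inr (ENNReal.natCast_ne_top m))
  refine tendsto_const_nhds.add (ENNReal.Tendsto.const_mul ?_
    (Or.inr (ENNReal.rpow_ne_top_of_nonneg hp0 ENNReal.ofReal_ne_top)))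
  simpa using tendsto_const_nhds.add h2

theorem cellBound_antitone (D : ℝ) (p η : ℝ) (m : ℕ) {M N : ℕ} (hM : 1 ≤ M) (hMN : M ≤ N) :
    cellBound D p η m N ≤ cellBound D p η m M := by
  have hM0 : (0 : ℝ) < M := by exact_mod_cast hM
  unfold cellBound
  gcongr

theorem tendsto_cellBound_limit (D : ℝ) {p : ℝ} (hp : 1 ≤ p) :
  Tendsto (fun k : ℕ => ENNReal.ofReal (1 / (k + 1)) ^ p +
    ENNReal.ofReal D ^ p * ENNReal.ofReal (1 / (k + 1))) atTop (𝓝 0) := by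
  have hp0 : 0 < p := zero_lt_one.trans_le hp
  have h1 : Tendsto (fun k : ℕ => ENNReal.ofReal (1 / (k + 1))) atTop (𝓝 0) := by
    simpa using ENNReal.tendsto_ofReal (tendsto_one_div_add_atTop_nhds_zero_nat (𝕜 := ℝ))
  have h2 := h1.ennrpow_const p
  rw [ENNReal.zero_rpow_of_pos hp0] at h2
  simpa using h2.add (ENNReal.Tendsto.const_mul h1
    (Or.inr (ENNReal.rpow_ne_top_of_nonneg hp0.le ENNReal.ofReal_ne_top)))

/-- For each `N` optimise over the scale `k`. A fine scale fixed first makes the limit in `N` small,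
so the infimum tends to zero; it inherits monotonicity from every scale. -/
theorem exists_rate_of_cellBound (D : ℝ) {p : ℝ} (hp : 1 ≤ p) (m : ℕ → ℕ) :
    ∃ ε : ℕ → ℝ, IsRate ε ∧ AntitoneOn ε (Set.Ici 1) ∧ ∀ N : ℕ, 1 ≤ N → ∀ v : ℝ≥0∞,
      (∀ k : ℕ, v ≤ cellBound D p (1 / (k + 1)) (m k) N) → v ≤ ENNReal.ofReal (ε N) ^ p := by
  have hp0 : 0 < p := zero_lt_one.trans_le hp
  let Φ : ℕ → ℝ≥0∞ := fun N => (⨅ k : ℕ, cellBound D p (1 / (k + 1)) (m k) N) ^ (1 / p)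
  have hΦ_top : ∀ N, Φ N ≠ ∞ := fun N => by
    refine ENNReal.rpow_ne_top_of_nonneg (by positivity) (ne_top_of_le_ne_top ?_ (iInf_le _ 0))
    have hr : ∀ x : ℝ, ENNReal.ofReal x ^ p ≠ ∞ := fun x =>
      ENNReal.rpow_ne_top_of_nonneg hp0.le ENNReal.ofReal_ne_top
    exact ENNReal.add_ne_top.2 ⟨hr _, ENNReal.mul_ne_top (hr _) (ENNReal.add_ne_top.2
      ⟨ENNReal.ofReal_ne_top, ENNReal.mul_ne_top (ENNReal.natCast_ne_top _) ENNReal.ofReal_ne_top⟩)⟩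
  have hΦ_anti : ∀ M N, 1 ≤ M → M ≤ N → Φ N ≤ Φ M := fun M N hM hMN => by
    simp only [Φ]
    gcongr with k
    exact cellBound_antitone D p _ _ hM hMN
  have hΦ_lim : Tendsto Φ atTop (𝓝 0) := by
    have h0 : Tendsto (fun N : ℕ => ⨅ k : ℕ, cellBound D p (1 / (k + 1)) (m k) N) atTop (𝓝 0) := by
      rw [ENNReal.tendsto_nhds_zero]
      intro c hc
      obtain ⟨k, hk⟩ := ((tendsto_cellBound_limit D hp).eventually_lt_const hc).exists
      filter_upwards [(tendsto_cellBound D hp (1 / (k + 1)) (m k)).eventually_lt_const hk] with N hN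
      exact (iInf_le _ k).trans hN.le
    have := h0.ennrpow_const (1 / p)
    rwa [ENNReal.zero_rpow_of_pos (by positivity)] at this
  -- The added `1 / N` makes the rate strictly positive even when `Φ N = 0`.
  refine ⟨fun N => (Φ N).toReal + 1 / N, ⟨fun N hN => ?_, ?_⟩, fun M hM N _ hMN => ?_,
    fun N _ v hv => ?_⟩
  · have : (0 : ℝ) < N := by exact_mod_cast hN
    positivity
  · have h1 := (ENNReal.tendsto_toReal ENNReal.zero_ne_top).comp hΦ_lim
    simpa using h1.add (tendsto_one_div_atTop_nhds_zero_nat (𝕜 := ℝ))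
  · have hM0 : (0 : ℝ) < M := by exact_mod_cast Set.mem_Ici.1 hM
    exact add_le_add (ENNReal.toReal_mono (hΦ_top M) (hΦ_anti M N hM hMN)) (by gcongr)
  · rw [← ENNReal.rpow_inv_le_iff hp0]
    calc v ^ p⁻¹ ≤ Φ N := by
          simp only [Φ, one_div]
          gcongr
          exact le_iInf fun k => by simpa only [one_div] using hv k
      _ = ENNReal.ofReal (Φ N).toReal := (ENNReal.ofReal_toReal (hΦ_top N)).symm
      _ ≤ _ := ENNReal.ofReal_le_ofReal (le_add_of_nonneg_right (by positivity))

/-! ### Measurability of `W_p` -/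

theorem measurable_of_tendsto_comap {X V Y : Type*} [MeasurableSpace X] [TopologicalSpace V]
    [MeasurableSpace V] [OpensMeasurableSpace V] [TopologicalSpace Y] [MeasurableSpace Y]
    [BorelSpace Y] {q : X → V} (hq : Measurable q) {w : X → Y}
    (hw : ∀ x, Tendsto w (comap q (𝓝 (q x))) (𝓝 (w x))) : Measurable w := by
  -- For the topology induced by `q`, `w` is continuous, and open sets are `q`-preimages of open
  -- sets, hence measurable.
  let : TopologicalSpace X := TopologicalSpace.induced q inferInstance
  have hcont : Continuous w := continuous_iff_continuousAt.2 fun x => by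
    rw [ContinuousAt, nhds_induced]
    exact hw x
  refine measurable_of_isOpen fun U hU => ?_
  obtain ⟨O, hO, hOU⟩ := isOpen_induced_iff.1 (hU.preimage hcont)
  rw [← hOU]
  exact hq hO.measurableSet

theorem exists_measure_compl_biUnion_lt {E : Type*} [MeasurableSpace E] {A : ℕ → Set E}
    (hA : ∀ i, MeasurableSet (A i)) (hcover : ⋃ i, A i = Set.univ) (ν : Measure E)
    [IsFiniteMeasure ν] {c : ℝ≥0∞} (hc : 0 < c) :
    ∃ m, ν (⋃ i ∈ Finset.range m, A i)ᶜ < c := by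
  have h := tendsto_measure_iInter_atTop (μ := ν) (s := fun m => (⋃ i ∈ Finset.range m, A i)ᶜ)
    (fun m => (Finset.measurableSet_biUnion _ fun i _ => hA i).compl.nullMeasurableSet)
    (fun m n hmn => Set.compl_subset_compl.2 (Set.biUnion_subset_biUnion_left fun i hi =>
      Finset.mem_range.2 ((Finset.mem_range.1 hi).trans_le hmn)))
    ⟨0, measure_ne_top _ _⟩
  have hempty : ⋂ m, (⋃ i ∈ Finset.range m, A i)ᶜ = ∅ := by
    rw [← Set.compl_iUnion, Set.compl_empty_iff, Set.eq_univ_iff_forall]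
    intro x
    obtain ⟨i, hi⟩ := Set.mem_iUnion.1 (hcover ▸ Set.mem_univ x : x ∈ ⋃ i, A i)
    exact Set.mem_iUnion.2 ⟨i + 1, Set.mem_iUnion₂.2 ⟨i, Finset.mem_range.2 i.lt_succ_self, hi⟩⟩
  rw [hempty, measure_empty] at h
  exact (h.eventually_lt_const hc).exists

section Wasserstein

variable {E : Type*} [MetricSpace E] [PolishSpace E] [MeasurableSpace E] [BorelSpace E]
  [BoundedSpace E]

/-- `W_p` is continuous in the masses of countably many cells: if these converge to the masses of
`ν`, the partition bound sends the distance to `ν` to zero. Those masses are measurable coordinates.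
-/
theorem measurable_wassersteinReal {p : ℝ} (hp : 1 ≤ p) :
    Measurable (Function.uncurry (wassersteinReal E p)) := by
  have hp0 : 0 < p := zero_lt_one.trans_le hp
  rcases isEmpty_or_nonempty E with hE | hE
  · have : IsEmpty (ProbabilityMeasure E × ProbabilityMeasure E) :=
      ⟨fun z => IsEmpty.false (ProbabilityMeasure.nonempty z.1).some⟩
    exact measurable_of_empty _
  obtain ⟨D, hD⟩ := exists_dist_le (E := E)
  choose A hA hdisj hdiam hcover _ using fun k : ℕ =>
    exists_cells (E := E) (η := 1 / ((k : ℝ) + 1)) (by positivity)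
  let q : ProbabilityMeasure E → ℕ → ℕ → ℝ≥0∞ := fun μ k i => (μ : Measure E) (A k i)
  have hq : Measurable q := measurable_pi_lambda _ fun k => measurable_pi_lambda _ fun i =>
    (Measure.measurable_coe (hA k i)).comp measurable_subtype_coe
  have hpow : ∀ ν : ProbabilityMeasure E, Tendsto
      (fun μ => wasserstein (dist : E → E → ℝ) p μ ν ^ p) (comap q (𝓝 (q ν))) (𝓝 0) := by
    intro ν
    rw [ENNReal.tendsto_nhds_zero]
    intro c hc
    obtain ⟨k, hk⟩ := ((tendsto_cellBound_limit D hp).eventually_lt_const hc).exists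
    have hη : (0 : ℝ) < 1 / ((k : ℝ) + 1) := by positivity
    obtain ⟨m, hm⟩ := exists_measure_compl_biUnion_lt (hA k) (hcover k) (ν : Measure E)
      (ENNReal.ofReal_pos.2 hη)
    have hcoord : ∀ i, Tendsto (fun μ : ProbabilityMeasure E => (μ : Measure E) (A k i))
        (comap q (𝓝 (q ν))) (𝓝 ((ν : Measure E) (A k i))) := fun i =>
      (((continuous_apply i).comp (continuous_apply k)).tendsto (q ν)).comp tendsto_comap
    have hsum : Tendsto (fun μ : ProbabilityMeasure E => ∑ i ∈ Finset.range m,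
        ((ν : Measure E) (A k i) - (μ : Measure E) (A k i))) (comap q (𝓝 (q ν))) (𝓝 0) := by
      have := tendsto_finsetSum (Finset.range m) fun i _ =>
        ENNReal.Tendsto.sub (tendsto_const_nhds (x := (ν : Measure E) (A k i))) (hcoord i)
          (Or.inl (measure_ne_top _ _))
      simpa using this
    have hbound := (tendsto_const_nhds (x := ENNReal.ofReal (1 / ((k : ℝ) + 1)) ^ p)).add
      (ENNReal.Tendsto.const_mul (a := ENNReal.ofReal D ^ p)
        ((tendsto_const_nhds (x := (ν : Measure E) (⋃ i ∈ Finset.range m, A k i)ᶜ)).add hsum)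
        (Or.inr (ENNReal.rpow_ne_top_of_nonneg hp0.le ENNReal.ofReal_ne_top)))
    rw [add_zero] at hbound
    have hlt : ENNReal.ofReal (1 / ((k : ℝ) + 1)) ^ p +
        ENNReal.ofReal D ^ p * (ν : Measure E) (⋃ i ∈ Finset.range m, A k i)ᶜ < c :=
      lt_of_le_of_lt (by gcongr) hk
    filter_upwards [hbound.eventually_lt_const hlt] with μ hμ
    exact (wasserstein_rpow_le_partition hD hp (Finset.range m) (fun i _ => hA k i)
      ((hdisj k).set_pairwise _) (fun i _ => hdiam k i) μ ν).trans hμ.le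
  have hzero : ∀ ν : ProbabilityMeasure E,
      Tendsto (fun μ => wassersteinReal E p μ ν) (comap q (𝓝 (q ν))) (𝓝 0) := by
    intro ν
    have h1 := (hpow ν).ennrpow_const p⁻¹
    rw [ENNReal.zero_rpow_of_pos (inv_pos.2 hp0)] at h1
    simp only [ENNReal.rpow_rpow_inv hp0.ne'] at h1
    exact (ENNReal.tendsto_toReal ENNReal.zero_ne_top).comp h1
  have hW := isMetricFun_wassersteinReal (E := E) hp
  -- Joint continuity follows from `hzero` in each variable, since the metric changes by at most the
  -- sum of the two displacements.
  refine measurable_of_tendsto_comap (q := fun y => (q y.1, q y.2)) (hq.prodMap hq) fun z => ?_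
  rw [nhds_prod_eq, ← prod_comap_comap_eq, tendsto_iff_dist_tendsto_zero]
  have hz := ((hzero z.1).comp (tendsto_fst (g := comap q (𝓝 (q z.2))))).add
    ((hzero z.2).comp (tendsto_snd (f := comap q (𝓝 (q z.1)))))
  rw [add_zero] at hz
  refine squeeze_zero (fun _ => dist_nonneg) (fun y => ?_) hz
  obtain ⟨μ, ν⟩ := y
  obtain ⟨μ₀, ν₀⟩ := z
  simp only [Function.uncurry, Function.comp_apply, Real.dist_eq, abs_le]
  have h1 := hW.triangle μ μ₀ ν
  have h2 := hW.triangle μ₀ ν₀ ν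
  have h3 := hW.triangle μ₀ μ ν₀
  have h4 := hW.triangle μ ν ν₀
  rw [hW.symm ν₀ ν] at h2
  rw [hW.symm μ₀ μ] at h3
  constructor <;> linarith

/-! ### Uniform and law-dependent rates for `W_p` -/

theorem exists_uniformLLN_wassersteinReal {p : ℝ} (hp : 1 ≤ p)
    (htb : TotallyBounded (Set.univ : Set E)) :
    ∃ ε : ℕ → ℝ, UniformLLN (wassersteinReal E p) p ε ∧ AntitoneOn ε (Set.Ici 1) := by
  have hp0 : 0 < p := zero_lt_one.trans_le hp
  rcases isEmpty_or_nonempty E with hE | hE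
  -- An empty space carries no probability measure, so any rate serves.
  · obtain ⟨ε, hε, hanti, -⟩ := exists_rate_of_cellBound 1 hp fun _ => 0
    exact ⟨ε, ⟨hε, fun N _ g => (IsEmpty.false (ProbabilityMeasure.nonempty g).some).elim⟩, hanti⟩
  obtain ⟨D, hD⟩ := exists_dist_le (E := E)
  choose A hA hdisj hdiam _ hfin using fun k : ℕ =>
    exists_cells (E := E) (η := 1 / ((k : ℝ) + 1)) (by positivity)
  choose m hm using fun k => hfin k htb
  obtain ⟨ε, hε, hanti, hle⟩ := exists_rate_of_cellBound D hp m
  refine ⟨ε, ⟨hε, fun N _ g _ => ?_⟩, hanti⟩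
  rw [← ENNReal.rpow_le_rpow_iff hp0]
  refine hle N NeZero.one_le _ fun k => ?_
  refine (iidError_wassersteinReal_rpow_le hD hp (hA k) (hdisj k) (hdiam k) (m k) N g).trans ?_
  rw [hm k, Set.compl_univ, measure_empty, cellBound]
  gcongr
  exact zero_le

/-- Linearity of expectation, using the one-coordinate marginals only; it turns the uncovered mass
of a random population into that of `g`. -/
theorem lintegral_empiricalMeasure_apply {X : Type*} [MeasurableSpace X] {K : ℕ} [NeZero K]
    {P : Measure (Fin K → X)} {g : Measure X} (hP : ∀ i, P.map (fun x => x i) = g) {R : Set X}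
    (hR : MeasurableSet R) : ∫⁻ x, (empiricalMeasure x : Measure X) R ∂P = g R := by
  have hK : (K : ℝ≥0∞) ≠ 0 := by exact_mod_cast NeZero.ne K
  change ∫⁻ x, ((K : ℝ≥0∞)⁻¹ • ∑ i, Measure.dirac (x i)) R ∂P = g R
  simp only [Measure.smul_apply, Measure.finsetSum_apply, smul_eq_mul, Measure.dirac_apply' _ hR]
  have hind : ∀ i, Measurable fun x : Fin K → X => R.indicator (1 : X → ℝ≥0∞) (x i) := fun i =>
    (measurable_one.indicator hR).comp (measurable_pi_apply i)
  rw [lintegral_const_mul _ (Finset.measurable_sum _ fun i _ => hind i),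
    lintegral_finsetSum _ fun i _ => hind i]
  have : ∀ i, ∫⁻ x, R.indicator (1 : X → ℝ≥0∞) (x i) ∂P = g R := fun i => by
    rw [← hP i, ← lintegral_map (measurable_one.indicator hR) (measurable_pi_apply i),
      lintegral_indicator_one hR]
  simp only [this, Finset.sum_const, Finset.card_univ, Fintype.card_fin, nsmul_eq_mul]
  rw [← mul_assoc, ENNReal.inv_mul_cancel hK (ENNReal.natCast_ne_top K), one_mul]

/-- At each scale choose finitely many cells covering all but a small mass of `g`. The last clause
holds because a population with marginals `g` has the same expected uncovered mass, though
individual populations may have more. -/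
theorem exists_rate_wassersteinReal {p : ℝ} (hp : 1 ≤ p) (g : ProbabilityMeasure E) :
    ∃ ε : ℕ → ℝ, IsRate ε ∧ AntitoneOn ε (Set.Ici 1) ∧
      (∀ (N : ℕ) [NeZero N], iidError (wassersteinReal E p) p N g ≤ ENNReal.ofReal (ε N)) ∧
      ∀ (N K : ℕ) [NeZero N] [NeZero K] (P : Measure (Fin K → E)) [IsProbabilityMeasure P],
        (∀ i, P.map (fun x => x i) = (g : Measure E)) →
        ∫⁻ x, iidError (wassersteinReal E p) p N (empiricalMeasure x) ^ p ∂P ≤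
          ENNReal.ofReal (ε N) ^ p := by
  have hp0 : 0 < p := zero_lt_one.trans_le hp
  have : Nonempty E := ProbabilityMeasure.nonempty g
  obtain ⟨D, hD⟩ := exists_dist_le (E := E)
  choose A hA hdisj hdiam hcover _ using fun k : ℕ =>
    exists_cells (E := E) (η := 1 / ((k : ℝ) + 1)) (by positivity)
  choose m hm using fun k : ℕ => exists_measure_compl_biUnion_lt (hA k) (hcover k) (g : Measure E)
    (ENNReal.ofReal_pos.2 (show (0 : ℝ) < 1 / ((k : ℝ) + 1) by positivity))
  obtain ⟨ε, hε, hanti, hle⟩ := exists_rate_of_cellBound D hp m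
  refine ⟨ε, hε, hanti, fun N _ => ?_, fun N K _ _ P _ hP => ?_⟩
  · rw [← ENNReal.rpow_le_rpow_iff hp0]
    refine hle N NeZero.one_le _ fun k => ?_
    refine (iidError_wassersteinReal_rpow_le hD hp (hA k) (hdisj k) (hdiam k) (m k) N g).trans ?_
    rw [cellBound]
    gcongr
    exact (hm k).le
  · refine hle N NeZero.one_le _ fun k => ?_
    have hR : MeasurableSet (⋃ i ∈ Finset.range (m k), A k i)ᶜ :=
      (Finset.measurableSet_biUnion _ fun i _ => hA k i).compl
    have hRm : Measurable fun x : Fin K → E =>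
        (empiricalMeasure x : Measure E) (⋃ i ∈ Finset.range (m k), A k i)ᶜ :=
      (Measure.measurable_coe hR).comp (measurable_subtype_coe.comp measurable_empiricalMeasure)
    refine (lintegral_mono fun x => iidError_wassersteinReal_rpow_le hD hp (hA k) (hdisj k)
      (hdiam k) (m k) N (empiricalMeasure x)).trans ?_
    rw [lintegral_add_left measurable_const, lintegral_const_mul' _ _
      (ENNReal.rpow_ne_top_of_nonneg hp0.le ENNReal.ofReal_ne_top), lintegral_add_left hRm,
      lintegral_empiricalMeasure_apply hP hR]
    simp only [lintegral_const, measure_univ, mul_one, cellBound]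
    gcongr
    exact (hm k).le

end Wasserstein

/-! ### Conclusion -/

theorem IsCompatibleSymmetric.map_eval {E : Type*} [MeasurableSpace E]
    {f : ∀ N : ℕ, ProbabilityMeasure (Fin N → E)} (hf : IsCompatibleSymmetric f)
    {K : ℕ} (i : Fin K) :
    (f K : Measure (Fin K → E)).map (fun x => x i) =
      (f 1 : Measure (Fin 1 → E)).map (fun x => x 0) := by
  rw [← hf.map_comp_injective le_rfl (i := fun _ : Fin 1 => i)
      (Function.injective_of_subsingleton _),
    Measure.map_map (measurable_pi_apply 0) (measurable_comp_index _)]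
  rfl

theorem corollaryI {E : Type*} [MetricSpace E] [PolishSpace E] [MeasurableSpace E] [BorelSpace E]
    (p : ℝ) (hp : 1 ≤ p) :
    -- the Cauchy estimate for every metric with a uniform law of large numbers
    (∀ δ : ProbabilityMeasure E → ProbabilityMeasure E → ℝ,
      IsMetricFun δ → Measurable (Function.uncurry δ) →
      ∀ ε : ℕ → ℝ, UniformLLN δ p ε →
      ∀ f : ∀ N : ℕ, ProbabilityMeasure (Fin N → E), IsCompatibleSymmetric f →
      ∀ (M N : ℕ) [NeZero M] [NeZero N], M ≤ N →
        wasserstein δ p (empiricalLaw (f M)) (empiricalLaw (f N)) ≤ ENNReal.ofReal (ε M + ε N) ∧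
        (AntitoneOn ε (Set.Ici 1) →
          wasserstein δ p (empiricalLaw (f M)) (empiricalLaw (f N)) ≤
            ENNReal.ofReal (2 * ε M))) ∧
    -- the Wasserstein distance of order `p` on a space with a bounded distance
    (BoundedSpace E →
      IsMetricFun (wassersteinReal E p) ∧
      Measurable (Function.uncurry (wassersteinReal E p)) ∧
      -- if `E` is totally bounded, the law of large numbers is uniform
      (TotallyBounded (Set.univ : Set E) →
        ∃ ε : ℕ → ℝ, UniformLLN (wassersteinReal E p) p ε ∧ AntitoneOn ε (Set.Ici 1) ∧
          ∀ f : ∀ N : ℕ, ProbabilityMeasure (Fin N → E), IsCompatibleSymmetric f →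
          ∀ (M N : ℕ) [NeZero M] [NeZero N], M ≤ N →
            wasserstein (wassersteinReal E p) p (empiricalLaw (f M)) (empiricalLaw (f N)) ≤
              ENNReal.ofReal (2 * ε M)) ∧
      -- in general, the rate depends on the law `g` of one particle
      (∀ g : ProbabilityMeasure E, ∃ ε : ℕ → ℝ, IsRate ε ∧ AntitoneOn ε (Set.Ici 1) ∧
        (∀ (N : ℕ) [NeZero N], iidError (wassersteinReal E p) p N g ≤ ENNReal.ofReal (ε N)) ∧
        ∀ f : ∀ N : ℕ, ProbabilityMeasure (Fin N → E), IsCompatibleSymmetric f →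
        (f 1 : Measure (Fin 1 → E)).map (fun x => x 0) = (g : Measure E) →
        ∀ (M N : ℕ) [NeZero M] [NeZero N], M ≤ N →
          wasserstein (wassersteinReal E p) p (empiricalLaw (f M)) (empiricalLaw (f N)) ≤
            ENNReal.ofReal (2 * ε M))) := by

  refine ⟨fun δ hδ hδm ε hε f hf M N _ _ hMN => ?_, fun _ => ?_⟩
  · exact wasserstein_empiricalLaw_le_of_rate hδ hδm hp hf hε.isRate
      (fun N K _ _ => hε.lintegral_iidError_le hp N K _) hMN
  have hW := isMetricFun_wassersteinReal (E := E) hp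
  have hWm := measurable_wassersteinReal (E := E) hp
  refine ⟨hW, hWm, fun htb => ?_, fun g => ?_⟩
  · obtain ⟨ε, hε, hanti⟩ := exists_uniformLLN_wassersteinReal hp htb
    exact ⟨ε, hε, hanti, fun f hf M N _ _ hMN =>
      (wasserstein_empiricalLaw_le_of_rate hW hWm hp hf hε.isRate
        (fun N K _ _ => hε.lintegral_iidError_le hp N K _) hMN).2 hanti⟩
  · obtain ⟨ε, hε, hanti, hiid, hle⟩ := exists_rate_wassersteinReal hp g
    exact ⟨ε, hε, hanti, fun N _ => hiid N, fun f hf hg M N _ _ hMN =>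
      (wasserstein_empiricalLaw_le_of_rate hW hWm hp hf hε
        (fun N K _ _ => hle N K _ fun i => (hf.map_eval i).trans hg) hMN).2 hanti⟩
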